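/- **Definitions.** Let $f$ be a real-valued function on square real matrices of all sizes that is invariant under relabelling of the index set, i.e. $f(P^{T}XP)=f(X)$ for every permutation matrix $P$. It is *diagonally block-additive* if $f(X)=f(X_1)+\cdots+f(X_s)$ for every block diagonal matrix $X$ with square diagonal blocks $X_1,\dots,X_s$. For $\gamma>0$ and integers $0\le k\le m$ let $$M_{m,k}=\begin{pmatrix}\mathbf 1_m\mathbf 1_m^{T}&0\\ \sqrt\gamma\,D_{m,k}&0\end{pmatrix}\in\mathbb R^{2m\times 2m},$$ where $\mathbf 1_m$ is the all-ones vector of length $m$ and $D_{m,k}$ is the $m\times m$ diagonal matrix whose first $k$ diagonal entries are $1$ and whose other entries are $0$. For even $t\ge2$ let $\mathcal E(t)$ and $\mathcal O(t)$ be the probability distributions on the even integers, respectively on the odd integers, in $\{0,\dots,t\}$ with density $q\mapsto\binom tq/2^{t-1}$. A stream is a finite sequence of updates $(i,j,v)$, meaning $X_{ij}\leftarrow X_{ij}+v$, applied to $X=0\in\mathbb R^{N\times N}$. A randomized streaming algorithm using $S$ bits reads the stream once with a memory of $S$ bits; its transition and output functions are arbitrary and may depend on $N$ and on a random string, which is not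 charged as memory. It approximates $f$ within a factor $1\pm c$ with error probability $\delta$ on a class of streams if for every stream of the class its output $Z$ violates $|Z-f(X)|\le c\,|f(X)|$ with probability at most $\delta$, where $X$ is the matrix at the end of the stream. **Theorem.** Let $t\ge2$ be even and $m\ge t$. For every $\delta<1/2$ there is a constant $K=K(t,m,\delta)>0$ such that the following holds. Let $\gamma>0$, and let $f$ be relabelling-invariant and diagonally block-additive with $$\mathbb E_{q\sim\mathcal E(t)}f(M_{m,q})-\mathbb E_{q\sim\mathcal O(t)}f(M_{m,q})\ne0 .$$ Then there is a constant $c>0$, depending only on $t,m,\gamma,f$, such that for every $\delta<1/2$ and all $N\ge N_0(t,m,\gamma,f,\delta)$, every randomized streaming algorithm that approximates $f(X)$, $X\in\mathbb R^{N\times N}$, within a factor $1\pm c$ with error probability $\delta$ uses at least $K(t,m,\delta)\,N^{1-1/t}$ bits of space. It suffices that the algorithm is correct on a class of streams that contains all streams which update every entry at most once and only with the values $1$ and $\sqrt\gamma$. -/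

import Mathlib

open MeasureTheory

/-- A real-valued function on square real matrices of all sizes. -/
abbrev SquareMatrixFunction : Type :=
  ∀ n : ℕ, Matrix (Fin n) (Fin n) ℝ → ℝ

/-- `f X = f X₁ + ⋯ + f Xₛ` for every block diagonal `X` with square diagonal blocks `X₁, …, Xₛ`. -/
def DiagonallyBlockAdditive (f : SquareMatrixFunction) : Prop :=
  ∀ (s : ℕ) (d : Fin s → ℕ) (B : ∀ i, Matrix (Fin (d i)) (Fin (d i)) ℝ),
    f (∑ i, d i) (Matrix.reindex finSigmaFinEquiv finSigmaFinEquiv (Matrix.blockDiagonal' B))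
      = ∑ i, f (d i) (B i)

/-- `f X` does not change when the index set of `X` is relabelled, i.e. when the same permutation
is applied to the rows and to the columns of `X`. -/
def RelabellingInvariant (f : SquareMatrixFunction) : Prop :=
  ∀ (n : ℕ) (σ : Equiv.Perm (Fin n)) (X : Matrix (Fin n) (Fin n) ℝ),
    f n (X.submatrix σ σ) = f n X

/-- The diagonal matrix `D_{m,k}`: the first `k` diagonal entries are `1`, the others are `0`. -/
def diagMat (m k : ℕ) : Matrix (Fin m) (Fin m) ℝ :=
  Matrix.diagonal fun i => if (i : ℕ) < k then 1 else 0

/-- The `2m × 2m` matrix `M_{m,k}` with blocks `𝟏𝟏ᵀ, 0` (top) and `√γ D_{m,k}, 0` (bottom). -/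
noncomputable def blockM (γ : ℝ) (m k : ℕ) : Matrix (Fin (m + m)) (Fin (m + m)) ℝ :=
  Matrix.reindex finSumFinEquiv finSumFinEquiv
    (Matrix.fromBlocks (Matrix.of fun _ _ => (1 : ℝ)) 0 (Real.sqrt γ • diagMat m k) 0)

/-- The density `p_t(q) = (t choose q) / 2^{t-1}`. -/
noncomputable def parityBinomialDensity (t q : ℕ) : ℝ :=
  (t.choose q : ℝ) / 2 ^ (t - 1)

/-- Expectation of `F q` for `q` drawn from the distribution with density `p_t` on the even
integers in `{0, …, t}`. -/
noncomputable def evenExpectation (t : ℕ) (F : ℕ → ℝ) : ℝ :=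
  ∑ q ∈ (Finset.range (t + 1)).filter (fun q => Even q), parityBinomialDensity t q * F q

/-- Expectation of `F q` for `q` drawn from the distribution with density `p_t` on the odd
integers in `{0, …, t}`. -/
noncomputable def oddExpectation (t : ℕ) (F : ℕ → ℝ) : ℝ :=
  ∑ q ∈ (Finset.range (t + 1)).filter (fun q => Odd q), parityBinomialDensity t q * F q

/-- An update `(i, j, v)` stands for the instruction `X i j ← X i j + v`. -/
structure Update (N : ℕ) where
  row : Fin N
  col : Fin N
  val : ℝ

/-- The matrix that a stream of updates builds from the zero matrix. -/
noncomputable def streamMatrix {N : ℕ} (s : List (Update N)) : Matrix (Fin N) (Fin N) ℝ :=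
  (s.map fun u => Matrix.single u.row u.col u.val).sum

/-- The streams which touch every matrix entry at most once and whose values lie in `V`. -/
def insertionStreams (N : ℕ) (V : Set ℝ) : Set (List (Update N)) :=
  {s | (s.map fun u => (u.row, u.col)).Nodup ∧ ∀ u ∈ s, u.val ∈ V}

/-- A deterministic one-pass streaming algorithm for `N × N` matrices whose memory consists of
`S` bits. The transition and output functions are arbitrary; only the memory is charged. -/
structure StreamingAlgorithm (N S : ℕ) where
  init : Fin S → Bool
  step : (Fin S → Bool) → Update N → (Fin S → Bool)
  output : (Fin S → Bool) → ℝ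

/-- The output after reading the stream `s` from left to right. -/
def StreamingAlgorithm.run {N S : ℕ} (A : StreamingAlgorithm N S) (s : List (Update N)) : ℝ :=
  A.output (s.foldl A.step A.init)

/-- A randomized streaming algorithm is a random deterministic one: the random string `ω ∼ μ` may
be read at every step and is not charged as memory. It approximates `f` within a factor `1 ± c`
with error probability at most `δ` on the class `𝒮` of streams if on every stream in `𝒮` its
output `Z` violates `|Z - f X| ≤ c |f X|` with probability at most `δ`, where `X` is the matrix
built by the stream. -/
def ApproximatesWithin {N S : ℕ} {Ω : Type*} [MeasurableSpace Ω] (μ : Measure Ω)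
    (A : Ω → StreamingAlgorithm N S) (f : SquareMatrixFunction) (𝒮 : Set (List (Update N)))
    (c δ : ℝ) : Prop :=
  ∀ s ∈ 𝒮, μ.real {ω | ¬ |(A ω).run s - f N (streamMatrix s)| ≤ c * |f N (streamMatrix s)|} ≤ δ

open scoped BigOperators

section Walsh

/-- The sign `-1` of `true` and `1` of `false`. -/
def boolSign (b : Bool) : ℝ := if b then -1 else 1

lemma boolSign_not (b : Bool) : boolSign (!b) = -boolSign b := by
  cases b <;> simp [boolSign]

lemma boolSign_mul_self (b : Bool) : boolSign b * boolSign b = 1 := by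
  cases b <;> simp [boolSign]

variable {V : Type*}

/-- The Walsh character of a set of coordinates. -/
def walsh (S : Finset V) (x : V → Bool) : ℝ := ∏ v ∈ S, boolSign (x v)

lemma sum_walsh_mul_walsh [Fintype V] (x y : V → Bool) :
    ∑ S : Finset V, walsh S x * walsh S y = if x = y then 2 ^ Fintype.card V else 0 := by
  have h : ∑ S : Finset V, walsh S x * walsh S y
      = ∏ v, (boolSign (x v) * boolSign (y v) + 1) := by
    rw [Finset.prod_add_one, Finset.powerset_univ]
    exact Finset.sum_congr rfl fun S _ => (Finset.prod_mul_distrib).symm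
  rw [h]
  split_ifs with hxy
  · subst hxy
    simp only [boolSign_mul_self]
    norm_num
  · obtain ⟨v, hv⟩ := Function.ne_iff.1 hxy
    refine Finset.prod_eq_zero (Finset.mem_univ v) ?_
    revert hv
    cases x v <;> cases y v <;> simp [boolSign]

variable [DecidableEq V]

/-- Negation of one coordinate. -/
def flipAt (v : V) (x : V → Bool) : V → Bool := Function.update x v (!x v)

lemma flipAt_self (v : V) (x : V → Bool) : flipAt v x v = !x v := by simp [flipAt]

lemma flipAt_of_ne {v u : V} (h : u ≠ v) (x : V → Bool) : flipAt v x u = x u := by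
  simp [flipAt, h]

lemma flipAt_involutive (v : V) : Function.Involutive (flipAt v) := by
  intro x
  ext u
  by_cases h : u = v
  · subst h; simp [flipAt_self]
  · simp [flipAt_of_ne h]

lemma walsh_flipAt_of_notMem {v : V} {S : Finset V} (h : v ∉ S) (x : V → Bool) :
    walsh S (flipAt v x) = walsh S x :=
  Finset.prod_congr rfl fun u hu => by rw [flipAt_of_ne (ne_of_mem_of_not_mem hu h)]

lemma walsh_insert {v : V} {S : Finset V} (h : v ∉ S) (x : V → Bool) :
    walsh (insert v S) x = boolSign (x v) * walsh S x := Finset.prod_insert h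

lemma walsh_flipAt_of_mem {v : V} {S : Finset V} (h : v ∈ S) (x : V → Bool) :
    walsh S (flipAt v x) = -walsh S x := by
  rw [← Finset.insert_erase h, walsh_insert (Finset.notMem_erase v S),
    walsh_insert (Finset.notMem_erase v S), walsh_flipAt_of_notMem (Finset.notMem_erase v S),
    flipAt_self, boolSign_not, neg_mul]

variable [Fintype V]

lemma expect_flipAt (v : V) (φ : (V → Bool) → ℝ) : 𝔼 x, φ (flipAt v x) = 𝔼 x, φ x :=
  Fintype.expect_equiv (flipAt_involutive v).toPerm _ _ fun _ => rfl

/-- The Walsh–Fourier coefficients of a function on the cube. -/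
noncomputable def walshCoeff (h : (V → Bool) → ℝ) (S : Finset V) : ℝ := 𝔼 x, h x * walsh S x

/-- Fourier inversion on the cube. -/
lemma sum_walshCoeff_mul_walsh (h : (V → Bool) → ℝ) (y : V → Bool) :
    ∑ S, walshCoeff h S * walsh S y = h y := by
  have h1 : ∑ S, walshCoeff h S * walsh S y
      = 𝔼 x, h x * ∑ S, walsh S x * walsh S y := by
    simp only [walshCoeff, Finset.expect_mul, Finset.mul_sum]
    rw [Finset.expect_sum_comm]
    simp only [mul_assoc]
  rw [h1]
  simp only [sum_walsh_mul_walsh, mul_ite, mul_zero]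
  rw [Fintype.expect_eq_sum_div_card]
  simp

/-- Parseval's identity on the cube. -/
lemma sum_walshCoeff_sq (h : (V → Bool) → ℝ) :
    ∑ S, walshCoeff h S ^ 2 = 𝔼 x, h x ^ 2 := by
  have h1 : (𝔼 x, h x ^ 2) = 𝔼 x, ∑ S, walshCoeff h S * (h x * walsh S x) := by
    refine Finset.expect_congr rfl fun x _ => ?_
    rw [sq]
    nth_rewrite 2 [← sum_walshCoeff_mul_walsh h x]
    rw [Finset.mul_sum]
    exact Finset.sum_congr rfl fun S _ => by ring
  rw [h1, Finset.expect_sum_comm]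
  refine Finset.sum_congr rfl fun S _ => ?_
  rw [← Finset.mul_expect, sq]
  rfl

end Walsh

section Hypercontractivity

lemma choose_two_mul_le (r i : ℕ) :
    ((2 * r).choose (2 * i) : ℝ) ≤ r.choose i * (2 * r - 1) ^ i := by
  rcases Nat.eq_zero_or_pos r with rfl | hr
  · rcases Nat.eq_zero_or_pos i with rfl | hi
    · simp
    · rw [Nat.choose_eq_zero_of_lt (by omega), Nat.choose_eq_zero_of_lt (by omega)]; simp
  have hr' : (1 : ℝ) ≤ r := by exact_mod_cast hr
  induction i with
  | zero => simp
  | succ i ih =>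
    rcases lt_or_ge r (i + 1) with h | h
    · rw [Nat.choose_eq_zero_of_lt (by omega : 2 * r < 2 * (i + 1)), Nat.choose_eq_zero_of_lt h]
      simp
    have h1 : ((2 * r).choose (2 * i + 1) : ℝ) * (2 * i + 1)
        = (2 * r).choose (2 * i) * (2 * r - 2 * i) := by
      have := Nat.choose_succ_right_eq (2 * r) (2 * i)
      have h' : ((2 * r - 2 * i : ℕ) : ℝ) = 2 * r - 2 * i := by
        rw [Nat.cast_sub (by omega)]; push_cast; ring
      rw [← h']
      exact_mod_cast this
    have h2 : ((2 * r).choose (2 * (i + 1)) : ℝ) * (2 * i + 2)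
        = (2 * r).choose (2 * i + 1) * (2 * r - 2 * i - 1) := by
      have := Nat.choose_succ_right_eq (2 * r) (2 * i + 1)
      have h' : ((2 * r - (2 * i + 1) : ℕ) : ℝ) = 2 * r - 2 * i - 1 := by
        rw [Nat.cast_sub (by omega)]; push_cast; ring
      rw [← h']
      exact_mod_cast this
    have h3 : (r.choose (i + 1) : ℝ) * (i + 1) = r.choose i * (r - i) := by
      have := Nat.choose_succ_right_eq r i
      have h' : ((r - i : ℕ) : ℝ) = r - i := by rw [Nat.cast_sub (by omega)]
      rw [← h']
      exact_mod_cast this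
    have hi : (i : ℝ) + 1 ≤ r := by exact_mod_cast h
    have hi0 : (0 : ℝ) ≤ i := i.cast_nonneg
    have key : ((2 * r).choose (2 * (i + 1)) : ℝ) * ((2 * i + 1) * (i + 1))
        ≤ (r.choose (i + 1) * (2 * r - 1) ^ (i + 1)) * ((2 * i + 1) * (i + 1)) := by
      calc ((2 * r).choose (2 * (i + 1)) : ℝ) * ((2 * i + 1) * (i + 1))
          = (2 * r).choose (2 * i) * ((r - i) * (2 * r - 2 * i - 1)) := by
            linear_combination ((2 * i + 1 : ℝ) / 2) * h2 + ((2 * r - 2 * i - 1 : ℝ) / 2) * h1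
        _ ≤ (r.choose i * (2 * r - 1) ^ i) * ((r - i) * (2 * r - 2 * i - 1)) := by
            refine mul_le_mul_of_nonneg_right ih ?_
            exact mul_nonneg (by linarith) (by linarith)
        _ ≤ (r.choose i * (2 * r - 1) ^ i) * ((r - i) * ((2 * r - 1) * (2 * i + 1))) := by
            refine mul_le_mul_of_nonneg_left ?_ ?_
            · refine mul_le_mul_of_nonneg_left ?_ (by linarith)
              nlinarith
            · exact mul_nonneg (Nat.cast_nonneg _) (pow_nonneg (by linarith) _)
        _ = _ := by
            rw [pow_succ]
            linear_combination (-((2 * r - 1 : ℝ) ^ i * (2 * r - 1) * (2 * i + 1))) * h3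
    exact le_of_mul_le_mul_right key (by positivity)

lemma add_pow_add_sub_pow (g h : ℝ) (r : ℕ) :
    (g + h) ^ (2 * r) + (g - h) ^ (2 * r)
      = 2 * ∑ i ∈ Finset.range (r + 1), (2 * r).choose (2 * i) * (g ^ 2) ^ (r - i) * (h ^ 2) ^ i := by
  have key : ∀ n : ℕ, ∀ F : ℕ → ℝ, ∑ k ∈ Finset.range (2 * n + 1), F k
      = ∑ i ∈ Finset.range (n + 1), F (2 * i) + ∑ i ∈ Finset.range n, F (2 * i + 1) := by
    intro n F
    induction n with
    | zero => simp
    | succ n ih =>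
      rw [show 2 * (n + 1) + 1 = 2 * n + 1 + 1 + 1 by ring, Finset.sum_range_succ,
        Finset.sum_range_succ, ih, Finset.sum_range_succ _ (n + 1),
        Finset.sum_range_succ (fun i => F (2 * i + 1)) n]
      ring_nf
  rw [add_comm g h, sub_eq_add_neg, add_comm g (-h), add_pow, add_pow, ← Finset.sum_add_distrib,
    key, Finset.sum_eq_zero (s := Finset.range r), add_zero, Finset.mul_sum]
  · refine Finset.sum_congr rfl fun i hi => ?_
    rw [Finset.mem_range] at hi
    rw [neg_pow, pow_mul (-1 : ℝ), ← pow_mul, ← pow_mul, show 2 * r - 2 * i = 2 * (r - i) by omega]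
    norm_num
    ring
  · intro i _
    rw [neg_pow, pow_succ (-1 : ℝ), pow_mul (-1 : ℝ)]
    norm_num

/-- The two-point inequality behind hypercontractivity for even exponents. -/
lemma two_point_inequality (g h : ℝ) (r : ℕ) :
    ((g + h) ^ (2 * r) + (g - h) ^ (2 * r)) / 2 ≤ (g ^ 2 + (2 * r - 1) * h ^ 2) ^ r := by
  rw [add_pow_add_sub_pow, mul_div_cancel_left₀ _ two_ne_zero, add_comm (g ^ 2), add_pow]
  refine Finset.sum_le_sum fun i _ => ?_
  have := mul_le_mul_of_nonneg_right (choose_two_mul_le r i)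
    (by positivity : (0 : ℝ) ≤ (g ^ 2) ^ (r - i) * (h ^ 2) ^ i)
  rw [mul_pow]
  linarith

lemma expect_add_pow_le {α : Type*} [Fintype α] {u v : α → ℝ} (hu : 0 ≤ u) (hv : 0 ≤ v)
    {r : ℕ} (hr : r ≠ 0) {a b : ℝ} (ha : 0 ≤ a) (hb : 0 ≤ b) (hua : 𝔼 x, u x ^ r ≤ a ^ r)
    (hvb : 𝔼 x, v x ^ r ≤ b ^ r) : 𝔼 x, (u x + v x) ^ r ≤ (a + b) ^ r := by
  cases isEmpty_or_nonempty α
  · simp only [Finset.univ_eq_empty, Finset.expect_empty]; positivity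
  have zero : ∀ {w : α → ℝ}, 0 ≤ w → 𝔼 x, w x ^ r ≤ 0 → ∀ x, w x = 0 := by
    intro w hw h0 x
    have h1 : (𝔼 x, w x ^ r) = 0 :=
      le_antisymm h0 (Finset.expect_nonneg fun x _ => pow_nonneg (hw x) r)
    rw [Finset.expect_eq_zero_iff_of_nonneg (fun x _ => pow_nonneg (hw x) r)] at h1
    exact pow_eq_zero_iff hr |>.1 (h1 x (Finset.mem_univ x))
  rcases ha.eq_or_lt with rfl | ha
  · simp only [zero hu (by simpa [hr] using hua), zero_add]; exact hvb
  rcases hb.eq_or_lt with rfl | hb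
  · simp only [zero hv (by simpa [hr] using hvb), add_zero]; exact hua
  have hpt : ∀ x, (u x + v x) ^ r
      ≤ (a + b) ^ r * (a / (a + b) * (u x ^ r / a ^ r) + b / (a + b) * (v x ^ r / b ^ r)) := by
    intro x
    have h1 := (convexOn_pow (𝕜 := ℝ) r).2 (div_nonneg (hu x) ha.le) (div_nonneg (hv x) hb.le)
      (by positivity : 0 ≤ a / (a + b)) (by positivity : 0 ≤ b / (a + b)) (by field_simp)
    simp only [smul_eq_mul, div_pow] at h1
    have h2 : a / (a + b) * (u x / a) + b / (a + b) * (v x / b) = (u x + v x) / (a + b) := by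
      field_simp
    rw [h2, div_pow, div_le_iff₀ (by positivity)] at h1
    linarith
  calc 𝔼 x, (u x + v x) ^ r
      ≤ 𝔼 x, (a + b) ^ r * (a / (a + b) * (u x ^ r / a ^ r) + b / (a + b) * (v x ^ r / b ^ r)) :=
        Finset.expect_le_expect fun x _ => hpt x
    _ = (a + b) ^ r * (a / (a + b) * ((𝔼 x, u x ^ r) / a ^ r)
          + b / (a + b) * ((𝔼 x, v x ^ r) / b ^ r)) := by
        rw [← Finset.mul_expect, Finset.expect_add_distrib, ← Finset.mul_expect,
          ← Finset.mul_expect, ← Finset.expect_div, ← Finset.expect_div]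
    _ ≤ (a + b) ^ r * (a / (a + b) * 1 + b / (a + b) * 1) := by
        gcongr
        · exact (div_le_one (by positivity)).2 hua
        · exact (div_le_one (by positivity)).2 hvb
    _ = (a + b) ^ r := by field_simp

variable {V : Type*} [DecidableEq V] [Fintype V]

/-- Hypercontractivity of the cube for even exponents. -/
theorem expect_walsh_sum_pow_le {r : ℕ} (hr : r ≠ 0) (U : Finset V) :
    ∀ c : Finset V → ℝ, 𝔼 x, (∑ S ∈ U.powerset, c S * walsh S x) ^ (2 * r)
      ≤ (∑ S ∈ U.powerset, (2 * r - 1 : ℝ) ^ S.card * c S ^ 2) ^ r := by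
  have hr1 : (1 : ℝ) ≤ r := by exact_mod_cast Nat.one_le_iff_ne_zero.2 hr
  induction U using Finset.induction_on with
  | empty => intro c; simp [walsh, pow_mul]
  | insert v U hv ih =>
    intro c
    set G : (V → Bool) → ℝ := fun x => ∑ S ∈ U.powerset, c S * walsh S x with hG
    set H : (V → Bool) → ℝ := fun x => ∑ S ∈ U.powerset, c (insert v S) * walsh S x with hH
    have hvS : ∀ S ∈ U.powerset, v ∉ S := fun S hS h => hv (Finset.mem_powerset.1 hS h)
    have hsplit : ∀ x, ∑ S ∈ (insert v U).powerset, c S * walsh S x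
        = G x + boolSign (x v) * H x := by
      intro x
      rw [Finset.sum_powerset_insert hv, hG, hH, Finset.mul_sum]
      congr 1
      refine Finset.sum_congr rfl fun S hS => ?_
      rw [walsh_insert (hvS S hS)]
      ring
    have hGf : ∀ x, G (flipAt v x) = G x := fun x =>
      Finset.sum_congr rfl fun S hS => by rw [walsh_flipAt_of_notMem (hvS S hS)]
    have hHf : ∀ x, H (flipAt v x) = H x := fun x =>
      Finset.sum_congr rfl fun S hS => by rw [walsh_flipAt_of_notMem (hvS S hS)]
    have hnn : ∀ c' : Finset V → ℝ,
        0 ≤ ∑ S ∈ U.powerset, (2 * r - 1 : ℝ) ^ S.card * c' S ^ 2 := fun c' =>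
      Finset.sum_nonneg fun S _ => mul_nonneg (pow_nonneg (by linarith) _) (sq_nonneg _)
    simp only [hsplit]
    calc 𝔼 x, (G x + boolSign (x v) * H x) ^ (2 * r)
        = 𝔼 x, ((G x + boolSign (x v) * H x) ^ (2 * r)
            + (G x - boolSign (x v) * H x) ^ (2 * r)) / 2 := by
          have h1 := expect_flipAt v fun x => (G x + boolSign (x v) * H x) ^ (2 * r)
          simp only [hGf, hHf, flipAt_self, boolSign_not, neg_mul, ← sub_eq_add_neg] at h1
          rw [← Finset.expect_div, Finset.expect_add_distrib, h1]
          ring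
      _ ≤ 𝔼 x, (G x ^ 2 + (2 * r - 1) * H x ^ 2) ^ r := by
          refine Finset.expect_le_expect fun x _ => (two_point_inequality _ _ r).trans_eq ?_
          rw [mul_pow, sq (boolSign _), boolSign_mul_self, one_mul]
      _ ≤ (∑ S ∈ U.powerset, (2 * r - 1 : ℝ) ^ S.card * c S ^ 2
            + (2 * r - 1) * ∑ S ∈ U.powerset,
                (2 * r - 1 : ℝ) ^ S.card * c (insert v S) ^ 2) ^ r := by
          refine expect_add_pow_le (fun x => sq_nonneg _)
            (fun x => mul_nonneg (by linarith) (sq_nonneg _)) hr (hnn c)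
            (mul_nonneg (by linarith) (hnn fun S => c (insert v S))) ?_ ?_
          · simpa only [← pow_mul] using ih c
          · simp only [mul_pow, ← Finset.mul_expect]
            refine mul_le_mul_of_nonneg_left ?_ (pow_nonneg (by linarith) _)
            simpa only [← pow_mul] using ih fun S => c (insert v S)
      _ = _ := by
          rw [Finset.sum_powerset_insert hv, Finset.mul_sum]
          congr 2
          refine Finset.sum_congr rfl fun S hS => ?_
          rw [Finset.card_insert_of_notMem (hvS S hS), pow_succ]
          ring

end Hypercontractivity

section LevelInequality

variable {V : Type*} [DecidableEq V] [Fintype V]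

/-- The Fourier weight of a function on the sets of size `j`. -/
noncomputable def levelWeight (h : (V → Bool) → ℝ) (j : ℕ) : ℝ :=
  ∑ S ∈ Finset.powersetCard j (Finset.univ : Finset V), walshCoeff h S ^ 2

lemma levelWeight_nonneg (h : (V → Bool) → ℝ) (j : ℕ) : 0 ≤ levelWeight h j :=
  Finset.sum_nonneg fun _ _ => sq_nonneg _

lemma expect_mul_pow_le {α : Type*} [Fintype α] {h : α → ℝ} (h0 : 0 ≤ h) (h1 : ∀ x, h x ≤ 1)
    (p : α → ℝ) (k : ℕ) :
    (𝔼 x, h x * p x) ^ (2 * (k + 1)) ≤ (𝔼 x, h x) ^ (2 * k + 1) * 𝔼 x, p x ^ (2 * (k + 1)) := by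
  cases isEmpty_or_nonempty α
  · simp
  set μ := 𝔼 x, h x with hμ
  have hμ0 : 0 ≤ μ := Finset.expect_nonneg fun x _ => h0 x
  have hpe : ∀ x, 0 ≤ p x ^ (2 * (k + 1)) := fun x => (even_two_mul _).pow_nonneg _
  rcases hμ0.eq_or_lt with hz | hpos
  · have hx : ∀ x, h x = 0 := fun x =>
      (Finset.expect_eq_zero_iff_of_nonneg fun x _ => h0 x).1 hz.symm x
        (Finset.mem_univ x)
    simp [hx, ← hz]
  have hc : (0 : ℝ) < Fintype.card α := by exact_mod_cast Fintype.card_pos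
  have hsum : ∑ x, h x = Fintype.card α * μ := by
    rw [hμ, Fintype.expect_eq_sum_div_card]; field_simp
  have J := (Even.convexOn_pow (𝕜 := ℝ) (even_two_mul (k + 1))).map_sum_le
    (t := Finset.univ) (w := fun x => h x / (Fintype.card α * μ)) (p := p)
    (fun x _ => div_nonneg (h0 x) (by positivity))
    (by rw [← Finset.sum_div, hsum, div_self (by positivity)]) (fun _ _ => Set.mem_univ _)
  simp only [smul_eq_mul] at J
  have e1 : ∑ x, h x / (Fintype.card α * μ) * p x = (𝔼 x, h x * p x) / μ := by
    rw [Fintype.expect_eq_sum_div_card, div_div, Finset.sum_div]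
    exact Finset.sum_congr rfl fun x _ => by ring
  have e2 : ∑ x, h x / (Fintype.card α * μ) * p x ^ (2 * (k + 1))
      = (𝔼 x, h x * p x ^ (2 * (k + 1))) / μ := by
    rw [Fintype.expect_eq_sum_div_card, div_div, Finset.sum_div]
    exact Finset.sum_congr rfl fun x _ => by ring
  rw [e1, e2, div_pow, div_le_div_iff₀ (by positivity) hpos] at J
  have h3 : (𝔼 x, h x * p x ^ (2 * (k + 1))) ≤ 𝔼 x, p x ^ (2 * (k + 1)) :=
    Finset.expect_le_expect fun x _ => mul_le_of_le_one_left (hpe x) (h1 x)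
  have h4 : (𝔼 x, h x * p x) ^ (2 * (k + 1)) * μ
      ≤ (μ ^ (2 * k + 1) * 𝔼 x, p x ^ (2 * (k + 1))) * μ := by
    refine J.trans ?_
    rw [show 2 * (k + 1) = 2 * k + 1 + 1 by ring, pow_succ μ]
    rw [show 2 * (k + 1) = 2 * k + 1 + 1 by ring] at h3
    have := mul_le_mul_of_nonneg_right h3 (by positivity : 0 ≤ μ ^ (2 * k + 1) * μ)
    linarith
  exact le_of_mul_le_mul_right h4 hpos

/-- The level inequality for functions with values in `[0, 1]`. -/
theorem levelWeight_pow_le {h : (V → Bool) → ℝ} (h0 : 0 ≤ h) (h1 : ∀ x, h x ≤ 1)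
    (j : ℕ) (k : ℕ) :
    levelWeight h j ^ (k + 1)
      ≤ (𝔼 x, h x) ^ (2 * k + 1) * ((2 * k + 1 : ℝ) ^ j) ^ (k + 1) := by
  have hμ0 : 0 ≤ 𝔼 x, h x := Finset.expect_nonneg fun x _ => h0 x
  rcases (levelWeight_nonneg h j).eq_or_lt with hz | hpos
  · rw [← hz, zero_pow (by omega)]; positivity
  set c : Finset V → ℝ := fun S => if S.card = j then walshCoeff h S else 0 with hc
  set p : (V → Bool) → ℝ := fun x => ∑ S ∈ Finset.univ.powerset, c S * walsh S x with hp
  have hfilter : Finset.powersetCard j (Finset.univ : Finset V)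
      = Finset.univ.filter fun S => S.card = j := by
    ext S; simp [Finset.mem_powersetCard]
  have hD : (𝔼 x, h x * p x) = levelWeight h j := by
    simp only [hp, Finset.mul_sum]
    rw [Finset.expect_sum_comm, levelWeight, hfilter, Finset.sum_filter, Finset.powerset_univ]
    refine Finset.sum_congr rfl fun S _ => ?_
    rw [show (𝔼 x, h x * (c S * walsh S x)) = c S * walshCoeff h S by
      rw [walshCoeff, Finset.mul_expect]
      exact Finset.expect_congr rfl fun x _ => by ring]
    simp only [hc]
    split_ifs <;> ring
  have hH := expect_walsh_sum_pow_le (Nat.succ_ne_zero k) (Finset.univ : Finset V) c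
  have hR : (∑ S ∈ (Finset.univ : Finset V).powerset,
      (2 * (k.succ : ℕ) - 1 : ℝ) ^ S.card * c S ^ 2) = (2 * k + 1 : ℝ) ^ j * levelWeight h j := by
    rw [levelWeight, hfilter, Finset.sum_filter, Finset.powerset_univ, Finset.mul_sum]
    refine Finset.sum_congr rfl fun S _ => ?_
    simp only [hc]
    split_ifs with hS
    · rw [hS]; push_cast; ring
    · simp
  rw [hR, mul_pow] at hH
  have hmain := expect_mul_pow_le h0 h1 p k
  rw [hD] at hmain
  have h5 : levelWeight h j ^ (k + 1) * levelWeight h j ^ (k + 1)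
      ≤ ((𝔼 x, h x) ^ (2 * k + 1) * ((2 * k + 1 : ℝ) ^ j) ^ (k + 1))
        * levelWeight h j ^ (k + 1) := by
    rw [← pow_add, ← two_mul]
    refine hmain.trans ?_
    rw [mul_assoc]
    exact mul_le_mul_of_nonneg_left hH (by positivity)
  exact le_of_mul_le_mul_right h5 (by positivity)

/-- The level inequality averaged over the cells of a partition of the cube. -/
theorem sum_levelWeight_div_le {A : Type*} [Fintype A] [DecidableEq A] (msg : (V → Bool) → A)
    {s j k : ℕ} (hA : Fintype.card A ≤ 2 ^ s) (hs : s ≤ j * (k + 1)) :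
    ∑ a, levelWeight (fun x => if msg x = a then 1 else 0) j
        / (𝔼 x, if msg x = a then (1 : ℝ) else 0) ≤ (4 * (k + 1) : ℝ) ^ j := by
  set h : A → (V → Bool) → ℝ := fun a x => if msg x = a then 1 else 0 with hh
  set μ : A → ℝ := fun a => 𝔼 x, h a x with hμ
  have h0 : ∀ a, 0 ≤ h a := fun a x => by simp only [hh]; split_ifs <;> simp
  have h1 : ∀ a x, h a x ≤ 1 := fun a x => by simp only [hh]; split_ifs <;> simp
  have hμ0 : ∀ a, 0 ≤ μ a := fun a => Finset.expect_nonneg fun x _ => h0 a x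
  have hμ1 : ∑ a, μ a = 1 := by
    simp only [hμ, hh]
    rw [← Finset.expect_sum_comm]
    simp
  have hW : ∀ a, μ a * (levelWeight (h a) j / μ a ^ 2) ^ (k + 1) ≤ ((2 * k + 1 : ℝ) ^ j) ^ (k + 1) := by
    intro a
    rcases (hμ0 a).eq_or_lt with hz | hpos
    · rw [← hz]; simp; positivity
    · rw [div_pow, ← mul_div_assoc, div_le_iff₀ (by positivity)]
      have := mul_le_mul_of_nonneg_left (levelWeight_pow_le (h0 a) (h1 a) j k) (hμ0 a)
      refine this.trans_eq ?_
      change μ a * (μ a ^ (2 * k + 1) * _) = _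
      ring
  have hrew : ∀ a, levelWeight (h a) j / μ a = μ a * (levelWeight (h a) j / μ a ^ 2) := by
    intro a
    rcases (hμ0 a).eq_or_lt with hz | hpos
    · rw [← hz]; simp
    · field_simp
  have J := (convexOn_pow (𝕜 := ℝ) (k + 1)).map_sum_le (t := Finset.univ) (w := μ)
    (p := fun a => levelWeight (h a) j / μ a ^ 2) (fun a _ => hμ0 a) hμ1
    (fun a _ => div_nonneg (levelWeight_nonneg _ _) (sq_nonneg _))
  simp only [smul_eq_mul] at J
  change ∑ a, levelWeight (h a) j / μ a ≤ _
  simp only [hrew]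
  refine le_of_pow_le_pow_left₀ (Nat.succ_ne_zero k) (by positivity) (J.trans ?_)
  calc ∑ a, μ a * (levelWeight (h a) j / μ a ^ 2) ^ (k + 1)
      ≤ ∑ _a : A, ((2 * k + 1 : ℝ) ^ j) ^ (k + 1) := Finset.sum_le_sum fun a _ => hW a
    _ = Fintype.card A * ((2 * k + 1 : ℝ) ^ j) ^ (k + 1) := by simp
    _ ≤ (2 ^ j) ^ (k + 1) * ((2 * k + 1 : ℝ) ^ j) ^ (k + 1) := by
        refine mul_le_mul_of_nonneg_right ?_ (by positivity)
        rw [← pow_mul]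
        have : (Fintype.card A : ℝ) ≤ 2 ^ s := by exact_mod_cast hA
        exact this.trans (pow_le_pow_right₀ one_le_two hs)
    _ ≤ ((4 * (k + 1) : ℝ) ^ j) ^ (k + 1) := by
        rw [← mul_pow, ← mul_pow]
        refine pow_le_pow_left₀ (by positivity) (pow_le_pow_left₀ (by positivity) ?_ _) _
        linarith [(k.cast_nonneg : (0 : ℝ) ≤ k)]

end LevelInequality

section Hypermatching

/-- Averaging over all permutations turns a function of a set of coordinates into its mean over
all sets of that size. -/
lemma expect_perm_map {V : Type*} [DecidableEq V] [Fintype V] (g : Finset V → ℝ) (S₀ : Finset V) :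
    (𝔼 σ : Equiv.Perm V, g (S₀.map σ.toEmbedding))
      = (∑ S ∈ Finset.powersetCard S₀.card Finset.univ, g S)
          / (Fintype.card V).choose S₀.card := by
  have h1 : ∀ S ∈ Finset.powersetCard S₀.card (Finset.univ : Finset V),
      (𝔼 σ : Equiv.Perm V, g (S.map σ.toEmbedding))
        = 𝔼 σ : Equiv.Perm V, g (S₀.map σ.toEmbedding) := by
    intro S hS
    obtain ⟨τ, hτ⟩ := Equiv.Perm.exists_map_finset_eq S₀ S (Finset.mem_powersetCard.1 hS).2.symm
    refine Fintype.expect_equiv (Equiv.mulRight τ) _ _ fun σ => ?_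
    rw [← hτ, Finset.map_map]
    rfl
  have h2 : ∑ S ∈ Finset.powersetCard S₀.card (Finset.univ : Finset V),
      (𝔼 σ : Equiv.Perm V, g (S.map σ.toEmbedding))
        = ∑ S ∈ Finset.powersetCard S₀.card Finset.univ, g S := by
    rw [← Finset.expect_sum_comm]
    have : ∀ σ : Equiv.Perm V,
        ∑ S ∈ Finset.powersetCard S₀.card (Finset.univ : Finset V), g (S.map σ.toEmbedding)
          = ∑ S ∈ Finset.powersetCard S₀.card Finset.univ, g S := by
      intro σ
      refine Finset.sum_equiv σ.finsetCongr (fun S => ?_) fun S _ => rfl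
      simp [Finset.mem_powersetCard]
    simp only [this]
    exact Fintype.expect_const _
  rw [← h2, Finset.sum_congr rfl h1, Finset.sum_const, Finset.card_powersetCard,
    Finset.card_univ, nsmul_eq_mul, mul_div_cancel_left₀]
  exact_mod_cast (Nat.choose_pos (Finset.card_le_univ S₀)).ne'

/-- The parity of a bit string. -/
def bitParity {κ : Type*} [Fintype κ] (y : κ → Bool) : Bool :=
  decide (Odd (Finset.univ.filter fun i => y i = true).card)

lemma boolSign_bitParity {κ : Type*} [Fintype κ] (y : κ → Bool) :
    boolSign (bitParity y) = ∏ i, boolSign (y i) := by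
  have h : ∏ i, boolSign (y i) = (-1) ^ (Finset.univ.filter fun i => y i = true).card := by
    simp only [boolSign]
    rw [Finset.prod_ite]
    simp
  rw [h, bitParity, boolSign]
  by_cases ho : Odd (Finset.univ.filter fun i => y i = true).card
  · simp [ho, ho.neg_one_pow]
  · simp [ho, (Nat.not_odd_iff_even.1 ho).neg_one_pow]

variable {V E κ : Type*} [Fintype κ]

/-- The parities of `x` on the hyperedges of a permuted hypermatching. -/
def edgeParity (emb : E × κ ↪ V) (σ : Equiv.Perm V) (x : V → Bool) : E → Bool :=
  fun e => bitParity fun i => x (σ (emb (e, i)))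

lemma walsh_edgeParity (emb : E × κ ↪ V) (σ : Equiv.Perm V) (x : V → Bool) (T : Finset E) :
    walsh T (edgeParity emb σ x)
      = walsh (((T ×ˢ (Finset.univ : Finset κ)).map emb).map σ.toEmbedding) x := by
  simp only [walsh, edgeParity, boolSign_bitParity, Finset.prod_map, Finset.prod_product]
  rfl

variable [DecidableEq V] [Fintype V]

/-- The Fourier weight on level `j` of the cells of a partition, normalized and averaged. -/
noncomputable def cellWeight {A : Type*} [Fintype A] [DecidableEq A] (msg : (V → Bool) → A)
    (j : ℕ) : ℝ :=
  ∑ a, levelWeight (fun x => if msg x = a then 1 else 0) j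
    / (𝔼 x, if msg x = a then (1 : ℝ) else 0)

variable [DecidableEq E] [Fintype E]

lemma sum_expect_mul_sq_le {A : Type*} [Fintype A] [DecidableEq A] (msg : (V → Bool) → A)
    (emb : E × κ ↪ V) (σ : Equiv.Perm V) (u : A → (E → Bool) → ℝ) (hu : ∀ a w, u a w ^ 2 ≤ 1)
    (hu0 : ∀ a, 𝔼 w, u a w = 0) :
    (𝔼 x, u (msg x) (edgeParity emb σ x)) ^ 2
      ≤ ∑ T ∈ (Finset.univ : Finset (Finset E)).erase ∅, ∑ a,
          walshCoeff (fun x => if msg x = a then 1 else 0)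
            (((T ×ˢ (Finset.univ : Finset κ)).map emb).map σ.toEmbedding) ^ 2
            / (𝔼 x, if msg x = a then (1 : ℝ) else 0) := by
  set h : A → (V → Bool) → ℝ := fun a x => if msg x = a then 1 else 0 with hh
  set μ : A → ℝ := fun a => 𝔼 x, h a x with hμ
  set R : Finset E → Finset V := fun T =>
    ((T ×ˢ (Finset.univ : Finset κ)).map emb).map σ.toEmbedding with hR
  have h0 : ∀ a x, 0 ≤ h a x := fun a x => by simp only [hh]; split_ifs <;> simp
  have hμ0 : ∀ a, 0 ≤ μ a := fun a => Finset.expect_nonneg fun x _ => h0 a x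
  have hμ1 : ∑ a, μ a = 1 := by
    simp only [hμ, hh]
    rw [← Finset.expect_sum_comm]
    simp
  have hE : (𝔼 x, u (msg x) (edgeParity emb σ x))
      = ∑ p ∈ (Finset.univ : Finset (Finset E)).erase ∅ ×ˢ (Finset.univ : Finset A),
          walshCoeff (u p.2) p.1 * walshCoeff (h p.2) (R p.1) := by
    have h1 : ∀ x, u (msg x) (edgeParity emb σ x)
        = ∑ T, ∑ a, walshCoeff (u a) T * (h a x * walsh (R T) x) := by
      intro x
      rw [Finset.sum_comm]
      have : ∀ a, ∑ T, walshCoeff (u a) T * (h a x * walsh (R T) x)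
          = h a x * u a (edgeParity emb σ x) := by
        intro a
        rw [← sum_walshCoeff_mul_walsh (u a) (edgeParity emb σ x), Finset.mul_sum]
        refine Finset.sum_congr rfl fun T _ => ?_
        rw [walsh_edgeParity]
        ring
      rw [Finset.sum_congr rfl fun a _ => this a]
      simp [hh]
    simp only [h1]
    rw [Finset.expect_sum_comm, Finset.sum_product, ← Finset.sum_erase (a := ∅) Finset.univ]
    · refine Finset.sum_congr rfl fun T _ => ?_
      rw [Finset.expect_sum_comm]
      refine Finset.sum_congr rfl fun a _ => ?_
      rw [← Finset.mul_expect]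
      rfl
    · rw [Finset.expect_sum_comm]
      refine Finset.sum_eq_zero fun a _ => ?_
      have : walshCoeff (u a) ∅ = 0 := by simp [walshCoeff, walsh, hu0 a]
      simp [this]
  rw [hE]
  refine (Finset.sum_sq_le_sum_mul_sum_of_sq_le_mul _
    (f := fun p => μ p.2 * walshCoeff (u p.2) p.1 ^ 2)
    (g := fun p => walshCoeff (h p.2) (R p.1) ^ 2 / μ p.2)
    (fun p _ => mul_nonneg (hμ0 _) (sq_nonneg _))
    (fun p _ => div_nonneg (sq_nonneg _) (hμ0 _)) fun p _ => ?_).trans ?_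
  · rcases (hμ0 p.2).eq_or_lt with hz | hpos
    · have hx : ∀ x, h p.2 x = 0 := fun x =>
        (Finset.expect_eq_zero_iff_of_nonneg fun x _ => h0 p.2 x).1 hz.symm x (Finset.mem_univ x)
      have : walshCoeff (h p.2) (R p.1) = 0 := by simp [walshCoeff, hx]
      simp [this]
    · rw [mul_pow]
      apply le_of_eq
      field_simp
  · have hf : ∑ p ∈ (Finset.univ : Finset (Finset E)).erase ∅ ×ˢ (Finset.univ : Finset A),
        μ p.2 * walshCoeff (u p.2) p.1 ^ 2 ≤ 1 := by
      rw [Finset.sum_product_right, ← hμ1]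
      refine Finset.sum_le_sum fun a _ => ?_
      dsimp only
      rw [← Finset.mul_sum]
      refine mul_le_of_le_one_right (hμ0 a) ?_
      calc ∑ T ∈ (Finset.univ : Finset (Finset E)).erase ∅, walshCoeff (u a) T ^ 2
          ≤ ∑ T, walshCoeff (u a) T ^ 2 :=
            Finset.sum_le_sum_of_subset_of_nonneg (Finset.erase_subset _ _)
              fun _ _ _ => sq_nonneg _
        _ = 𝔼 w, u a w ^ 2 := sum_walshCoeff_sq _
        _ ≤ 1 := Finset.expect_le (Finset.univ_nonempty) fun w _ => hu a w
    rw [← Finset.sum_product']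
    exact mul_le_of_le_one_left
      (Finset.sum_nonneg fun p _ => div_nonneg (sq_nonneg _) (hμ0 _)) hf

/-- The advantage of a one-way protocol for the Boolean hidden hypermatching problem is controlled
by the Fourier weights of the cells of its message function. -/
theorem advantage_sq_le {A : Type*} [Fintype A] [DecidableEq A] (msg : (V → Bool) → A)
    (emb : E × κ ↪ V) (G : A → Equiv.Perm V → (E → Bool) → ℝ)
    (hG0 : ∀ a σ w, 0 ≤ G a σ w) (hG1 : ∀ a σ w, G a σ w ≤ 1) :
    (𝔼 σ : Equiv.Perm V, 𝔼 x, (G (msg x) σ (edgeParity emb σ x)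
        - G (msg x) σ fun e => !edgeParity emb σ x e)) ^ 2
      ≤ ∑ k ∈ Finset.Icc 1 (Fintype.card E), ((Fintype.card E).choose k : ℝ)
          * (cellWeight msg (k * Fintype.card κ)
            / (Fintype.card V).choose (k * Fintype.card κ)) := by
  set u : Equiv.Perm V → A → (E → Bool) → ℝ := fun σ a w => G a σ w - G a σ fun e => !w e with hu
  have hu1 : ∀ σ a w, u σ a w ^ 2 ≤ 1 := by
    intro σ a w
    rw [sq_le_one_iff_abs_le_one, abs_le]
    constructor <;> simp only [hu] <;>
      linarith [hG0 a σ w, hG1 a σ w, hG0 a σ fun e => !w e, hG1 a σ fun e => !w e]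
  have hu0 : ∀ σ a, 𝔼 w, u σ a w = 0 := by
    intro σ a
    simp only [hu]
    rw [Finset.expect_sub_distrib, sub_eq_zero]
    have hinv : Function.Involutive fun (w : E → Bool) e => !w e := fun w => by ext; simp
    exact Fintype.expect_equiv hinv.toPerm _ _ fun w => by
      change _ = G a σ fun e => !(!w e)
      simp
  have hJ : (𝔼 σ : Equiv.Perm V, 𝔼 x, u σ (msg x) (edgeParity emb σ x)) ^ 2
      ≤ 𝔼 σ : Equiv.Perm V, (𝔼 x, u σ (msg x) (edgeParity emb σ x)) ^ 2 := by
    have := Finset.expect_mul_sq_le_sq_mul_sq (Finset.univ : Finset (Equiv.Perm V))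
      (fun _ => (1 : ℝ)) fun σ => 𝔼 x, u σ (msg x) (edgeParity emb σ x)
    simpa using this
  refine hJ.trans ((Finset.expect_le_expect fun σ _ =>
    sum_expect_mul_sq_le msg emb σ (u σ) (hu1 σ) (hu0 σ)).trans_eq ?_)
  rw [Finset.expect_sum_comm]
  have hT : ∀ T : Finset E, (𝔼 σ : Equiv.Perm V, ∑ a,
      walshCoeff (fun x => if msg x = a then 1 else 0)
        (((T ×ˢ (Finset.univ : Finset κ)).map emb).map σ.toEmbedding) ^ 2
        / (𝔼 x, if msg x = a then (1 : ℝ) else 0))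
      = cellWeight msg (T.card * Fintype.card κ)
          / (Fintype.card V).choose (T.card * Fintype.card κ) := by
    intro T
    rw [expect_perm_map (fun S => ∑ a, walshCoeff (fun x => if msg x = a then 1 else 0) S ^ 2
      / (𝔼 x, if msg x = a then (1 : ℝ) else 0)), Finset.card_map, Finset.card_product,
      Finset.card_univ, Finset.sum_comm, cellWeight]
    simp only [levelWeight, Finset.sum_div]
  simp only [hT]
  have h2 := Finset.sum_powerset_apply_card (fun k => cellWeight msg (k * Fintype.card κ)
    / ((Fintype.card V).choose (k * Fintype.card κ) : ℝ)) (x := (Finset.univ : Finset E))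
  rw [Finset.powerset_univ, ← Finset.add_sum_erase _ _ (Finset.mem_univ ∅),
    Finset.card_univ, Finset.sum_range_succ'] at h2
  simp only [Finset.card_empty, Nat.choose_zero_right, one_smul, nsmul_eq_mul] at h2
  rw [add_comm, add_right_cancel_iff] at h2
  rw [h2, Finset.range_eq_Ico, Finset.sum_Ico_add' (fun k => ((Fintype.card E).choose k : ℝ)
    * (cellWeight msg (k * Fintype.card κ) / (Fintype.card V).choose (k * Fintype.card κ)))]
  rfl

end Hypermatching

section Estimates

lemma choose_le_three_mul_div_pow (B k : ℕ) (hk : 0 < k) :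
    (B.choose k : ℝ) ≤ (3 * (B / k)) ^ k := by
  have hk' : (0 : ℝ) < k := by exact_mod_cast hk
  have h1 := Nat.choose_le_pow_div (α := ℝ) k B
  have h2 := Real.pow_div_factorial_le_exp (k : ℝ) k.cast_nonneg k
  have h3 : Real.exp k ≤ 3 ^ k := by
    rw [← Real.exp_one_pow]
    exact pow_le_pow_left₀ (Real.exp_pos _).le (by linarith [Real.exp_one_lt_d9]) _
  rw [div_le_iff₀ (by positivity)] at h2
  refine h1.trans ?_
  rw [div_le_iff₀ (by positivity), mul_pow, div_pow]
  have h4 : (k : ℝ) ^ k ≤ 3 ^ k * k.factorial := h2.trans (by gcongr)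
  calc (B : ℝ) ^ k = B ^ k / k ^ k * k ^ k := by field_simp
    _ ≤ B ^ k / k ^ k * (3 ^ k * k.factorial) := by gcongr
    _ = _ := by ring

lemma div_pow_le_choose (n r : ℕ) (hr : 0 < r) (h : 2 * r ≤ n) :
    ((n : ℝ) / (2 * r)) ^ r ≤ n.choose r := by
  have hr' : (0 : ℝ) < r := by exact_mod_cast hr
  refine le_trans ?_ (Nat.pow_le_choose (α := ℝ) r n)
  have h1 : (n : ℝ) / 2 ≤ (n + 1 - r : ℕ) := by
    rw [Nat.cast_sub (by omega)]
    have : (2 : ℝ) * r ≤ n := by exact_mod_cast h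
    push_cast
    linarith
  have h2 : (r.factorial : ℝ) ≤ r ^ r := by exact_mod_cast Nat.factorial_le_pow r
  calc ((n : ℝ) / (2 * r)) ^ r = (n / 2) ^ r / r ^ r := by rw [← div_pow, div_div]
    _ ≤ _ := by gcongr

lemma hypermatching_term_le {t B s k : ℕ} (ht : 2 ≤ t) (hk : 1 ≤ k) (hkB : k ≤ B) :
    (B.choose k : ℝ) * ((4 * ((s / (k * t) : ℕ) + 1)) ^ (k * t) / (64 * t * B).choose (k * t))
      ≤ (3 / 32 * ((s : ℝ) ^ t / B ^ (t - 1) + k / B)) ^ k := by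
  have hk' : (1 : ℝ) ≤ k := by exact_mod_cast hk
  have hkB' : (k : ℝ) ≤ B := by exact_mod_cast hkB
  have hB' : (1 : ℝ) ≤ B := hk'.trans hkB'
  have ht' : (2 : ℝ) ≤ t := by exact_mod_cast ht
  have hkt : 0 < k * t := by positivity
  have h1 := choose_le_three_mul_div_pow B k hk
  have h2 := div_pow_le_choose (64 * t * B) (k * t) hkt (by nlinarith)
  have h3 : ((s / (k * t) : ℕ) : ℝ) ≤ s / (k * t) := by
    have := Nat.cast_div_le (α := ℝ) (m := s) (n := k * t)
    simpa using this
  have h4 : (4 * (((s / (k * t) : ℕ) : ℝ) + 1)) ^ (k * t) / (64 * t * B).choose (k * t)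
      ≤ (((s + k) / (8 * B)) ^ t) ^ k := by
    calc (4 * (((s / (k * t) : ℕ) : ℝ) + 1)) ^ (k * t) / (64 * t * B).choose (k * t)
        ≤ (4 * (s / (k * t) + 1 : ℝ)) ^ (k * t)
            / (((64 * t * B : ℕ) : ℝ) / (2 * (k * t : ℕ))) ^ (k * t) := by
          have hB0 : (0 : ℝ) < (64 * t * B : ℕ) := by push_cast; positivity
          gcongr
      _ = ((s / t + k) / (8 * B) : ℝ) ^ (k * t) := by
          rw [← div_pow]
          congr 1
          push_cast
          field_simp
          ring
      _ ≤ ((s + k) / (8 * B) : ℝ) ^ (k * t) := by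
          gcongr
          exact div_le_self (Nat.cast_nonneg _) (by linarith)
      _ = _ := by rw [mul_comm k, pow_mul]
  calc (B.choose k : ℝ) * ((4 * ((s / (k * t) : ℕ) + 1)) ^ (k * t)
        / (64 * t * B).choose (k * t))
      ≤ (3 * (B / k)) ^ k * (((s + k) / (8 * B)) ^ t) ^ k := by gcongr
    _ = (3 * (B / k) * ((s + k) / (8 * B)) ^ t) ^ k := by rw [← mul_pow]
    _ ≤ _ := by
        refine pow_le_pow_left₀ (by positivity) ?_ _
        obtain ⟨q, rfl⟩ : ∃ q, t = q + 2 := ⟨t - 2, by omega⟩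
        rw [show q + 2 - 1 = q + 1 by omega]
        have h5 : ((s : ℝ) + k) ^ (q + 2) ≤ 2 ^ (q + 1) * ((s : ℝ) ^ (q + 2) + k ^ (q + 2)) := by
          have := add_pow_le (Nat.cast_nonneg (α := ℝ) s) (Nat.cast_nonneg k) (q + 2)
          simpa using this
        have h6 : (2 : ℝ) ^ (q + 1) * 32 ≤ 8 ^ (q + 2) := by
          rw [pow_succ, pow_succ, pow_succ]
          have := pow_le_pow_left₀ (by norm_num : (0 : ℝ) ≤ 2) (by norm_num : (2 : ℝ) ≤ 8) q
          linarith
        have h7 : (k : ℝ) ^ (q + 2) ≤ k * (k * B ^ q) := by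
          rw [pow_succ, pow_succ]
          have := pow_le_pow_left₀ (by linarith) hkB' q
          nlinarith [mul_nonneg (by linarith : (0 : ℝ) ≤ k) (by linarith : (0 : ℝ) ≤ k)]
        calc 3 * (B / k : ℝ) * ((s + k) / (8 * B)) ^ (q + 2)
            ≤ 3 * (B / k : ℝ) * (2 ^ (q + 1) * ((s : ℝ) ^ (q + 2) + k ^ (q + 2))
                / ((2 ^ (q + 1) * 32) * B ^ (q + 2))) := by
              rw [div_pow, mul_pow]
              gcongr
          _ = 3 / 32 * (((s : ℝ) ^ (q + 2) / k + k ^ (q + 2) / k) / B ^ (q + 1)) := by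
              field_simp
              ring
          _ ≤ 3 / 32 * (((s : ℝ) ^ (q + 2) + k * B ^ q) / B ^ (q + 1)) := by
              gcongr
              · exact div_le_self (by positivity) hk'
              · rw [div_le_iff₀ (by linarith)]
                linarith
          _ = _ := by
              rw [add_div, pow_succ (B : ℝ) q]
              congr 2
              field_simp

lemma sum_add_mul_half_pow_le {a b : ℝ} (ha : 0 ≤ a) (hb : 0 ≤ b) (n : ℕ) :
    ∑ i ∈ Finset.range n, (a + (i + 1) * b) * (1 / 2) ^ i ≤ 2 * a + 4 * b := by
  have h : ∑ i ∈ Finset.range n, (a + (i + 1) * b) * (1 / 2) ^ i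
      = 2 * a + 4 * b - (2 * a + (2 * n + 4) * b) * (1 / 2) ^ n := by
    induction n with
    | zero => simp
    | succ n ih =>
      rw [Finset.sum_range_succ, ih, pow_succ]
      push_cast
      ring
  rw [h, sub_le_self_iff]
  positivity

/-- A message of `s ≪ B ^ (1 - 1/t)` bits has small advantage. -/
lemma sum_hypermatching_term_le {t B s : ℕ} (ht : 2 ≤ t) (hB : 1 ≤ B)
    (hs : (s : ℝ) ^ t / B ^ (t - 1) ≤ 1) :
    ∑ k ∈ Finset.Icc 1 B, (B.choose k : ℝ)
        * ((4 * ((s / (k * t) : ℕ) + 1)) ^ (k * t) / (64 * t * B).choose (k * t))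
      ≤ (s : ℝ) ^ t / B ^ (t - 1) + 1 / B := by
  set ε : ℝ := (s : ℝ) ^ t / B ^ (t - 1) with hε
  have hε0 : 0 ≤ ε := by positivity
  have hB' : (1 : ℝ) ≤ B := by exact_mod_cast hB
  calc _ ≤ ∑ k ∈ Finset.Icc 1 B, (3 / 32 * (ε + k / B)) ^ k :=
        Finset.sum_le_sum fun k hk => hypermatching_term_le ht (Finset.mem_Icc.1 hk).1
          (Finset.mem_Icc.1 hk).2
    _ = ∑ i ∈ Finset.range B, (3 / 32 * (ε + (i + 1 : ℕ) / B)) ^ (i + 1) := by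
        rw [Finset.range_eq_Ico,
          Finset.sum_Ico_add' (fun k : ℕ => (3 / 32 * (ε + (k : ℝ) / B)) ^ k)]
        rfl
    _ ≤ ∑ i ∈ Finset.range B, 3 / 32 * ((ε + (i + 1) * (1 / B)) * (1 / 2) ^ i) := by
        refine Finset.sum_le_sum fun i hi => ?_
        have hi' : ((i + 1 : ℕ) : ℝ) ≤ B := by exact_mod_cast Finset.mem_range.1 hi
        have h1 : ((i + 1 : ℕ) : ℝ) / B ≤ 1 := (div_le_one (by linarith)).2 hi'
        have h0 : 0 ≤ ((i + 1 : ℕ) : ℝ) / B := by positivity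
        have h2 : (3 / 32 * (ε + (i + 1 : ℕ) / B)) ^ i ≤ (1 / 2 : ℝ) ^ i :=
          pow_le_pow_left₀ (by positivity) (by linarith) _
        rw [pow_succ]
        calc _ ≤ (1 / 2 : ℝ) ^ i * (3 / 32 * (ε + (i + 1 : ℕ) / B)) := by gcongr
          _ = _ := by push_cast; ring
    _ = 3 / 32 * ∑ i ∈ Finset.range B, (ε + (i + 1) * (1 / B)) * (1 / 2) ^ i :=
        (Finset.mul_sum _ _ _).symm
    _ ≤ 3 / 32 * (2 * ε + 4 * (1 / B)) := by
        gcongr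
        exact sum_add_mul_half_pow_le hε0 (by positivity) B
    _ ≤ ε + 1 / B := by
        have : (0 : ℝ) ≤ 1 / B := by positivity
        linarith

/-- The Boolean hidden hypermatching lower bound in distributional form: a one-way protocol whose
message has `s` bits has advantage `O(√(s ^ t / B ^ (t - 1) + 1 / B))`. -/
theorem advantage_sq_le_of_bits {V A : Type*} [DecidableEq V] [Fintype V] [Fintype A]
    [DecidableEq A] {t B s : ℕ} (ht : 2 ≤ t) (hB : 1 ≤ B)
    (hs : (s : ℝ) ^ t / B ^ (t - 1) ≤ 1) (hV : Fintype.card V = 64 * t * B)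
    (hA : Fintype.card A ≤ 2 ^ s) (msg : (V → Bool) → A)
    (emb : Fin B × Fin t ↪ V) (G : A → Equiv.Perm V → (Fin B → Bool) → ℝ)
    (hG0 : ∀ a σ w, 0 ≤ G a σ w) (hG1 : ∀ a σ w, G a σ w ≤ 1) :
    (𝔼 σ : Equiv.Perm V, 𝔼 x, (G (msg x) σ (edgeParity emb σ x)
        - G (msg x) σ fun e => !edgeParity emb σ x e)) ^ 2
      ≤ (s : ℝ) ^ t / B ^ (t - 1) + 1 / B := by
  refine (advantage_sq_le msg emb G hG0 hG1).trans
    (le_trans ?_ (sum_hypermatching_term_le ht hB hs))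
  rw [Fintype.card_fin, Fintype.card_fin, hV]
  refine Finset.sum_le_sum fun k hk => ?_
  have hk1 : 1 ≤ k := (Finset.mem_Icc.1 hk).1
  gcongr
  have hkt : 0 < k * t := Nat.mul_pos hk1 (by omega)
  exact sum_levelWeight_div_le msg hA (by
    have := Nat.lt_mul_div_succ s hkt
    omega)

end Estimates

section EvalOn

/-- The value of a square matrix function on a matrix indexed by an arbitrary finite type. -/
noncomputable def evalOn (f : SquareMatrixFunction) {ι : Type*} [Fintype ι] (X : Matrix ι ι ℝ) : ℝ :=
  f (Fintype.card ι) (X.submatrix (Fintype.equivFin ι).symm (Fintype.equivFin ι).symm)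

variable {f : SquareMatrixFunction}

lemma evalOn_eq (hf : RelabellingInvariant f) {ι : Type*} [Fintype ι] {n : ℕ} (e : Fin n ≃ ι)
    (X : Matrix ι ι ℝ) : evalOn f X = f n (X.submatrix e e) := by
  obtain rfl : n = Fintype.card ι := by simpa using Fintype.card_congr e
  rw [evalOn, ← hf _ (e.trans (Fintype.equivFin ι)), Matrix.submatrix_submatrix]
  congr 2 <;> ext <;> simp

lemma evalOn_submatrix (hf : RelabellingInvariant f) {ι ι' : Type*} [Fintype ι] [Fintype ι']
    (e : ι' ≃ ι) (X : Matrix ι ι ℝ) : evalOn f (X.submatrix e e) = evalOn f X := by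
  rw [evalOn_eq hf ((Fintype.equivFin ι').symm.trans e), evalOn, Matrix.submatrix_submatrix]
  rfl

lemma evalOn_blockDiagonal' (hf : RelabellingInvariant f) (ha : DiagonallyBlockAdditive f)
    {o : Type*} [Fintype o] [DecidableEq o] {κ : o → Type*} [∀ i, Fintype (κ i)]
    (X : ∀ i, Matrix (κ i) (κ i) ℝ) :
    evalOn f (Matrix.blockDiagonal' X) = ∑ i, evalOn f (X i) := by
  set e := (Fintype.equivFin o).symm with he
  set Y : ∀ i, Matrix (Fin (Fintype.card (κ (e i)))) (Fin (Fintype.card (κ (e i)))) ℝ :=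
    fun i => (X (e i)).submatrix (Fintype.equivFin _).symm (Fintype.equivFin _).symm with hY
  have h := ha (Fintype.card o) (fun i => Fintype.card (κ (e i))) Y
  rw [← Equiv.sum_comp e fun i => evalOn f (X i)]
  refine Eq.trans ?_ h
  rw [evalOn_eq hf (finSigmaFinEquiv.symm.trans
    (Equiv.sigmaCongr e fun i => (Fintype.equivFin (κ (e i))).symm))]
  congr 1
  ext a b
  simp only [Matrix.submatrix_apply, Matrix.reindex_apply, Equiv.trans_apply]
  obtain ⟨i, a'⟩ := finSigmaFinEquiv.symm a
  obtain ⟨j, b'⟩ := finSigmaFinEquiv.symm b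
  by_cases hij : i = j
  · subst hij
    exact (Matrix.blockDiagonal'_apply_eq X (e i) _ _).trans
      (Matrix.blockDiagonal'_apply_eq Y i a' b').symm
  · exact (Matrix.blockDiagonal'_apply_ne X _ _ (e.injective.ne hij)).trans
      (Matrix.blockDiagonal'_apply_ne Y a' b' hij).symm

lemma evalOn_blockDiagonal (hf : RelabellingInvariant f) (ha : DiagonallyBlockAdditive f)
    {o κ : Type*} [Fintype o] [DecidableEq o] [Fintype κ] (X : o → Matrix κ κ ℝ) :
    evalOn f (Matrix.blockDiagonal X) = ∑ i, evalOn f (X i) := by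
  rw [← evalOn_blockDiagonal' hf ha, ← evalOn_submatrix hf
    ((Equiv.sigmaEquivProd o κ).trans (Equiv.prodComm o κ))]
  congr 1

lemma evalOn_fromBlocks.{u} (hf : RelabellingInvariant f) (ha : DiagonallyBlockAdditive f)
    {ι ι' : Type u} [Fintype ι] [Fintype ι'] (X : Matrix ι ι ℝ) (Y : Matrix ι' ι' ℝ) :
    evalOn f (Matrix.fromBlocks X 0 0 Y) = evalOn f X + evalOn f Y := by
  let κ : Bool → Type u := fun b => bif b then ι' else ι
  let : ∀ b, Fintype (κ b) := fun b => match b with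
    | true => (inferInstance : Fintype ι')
    | false => (inferInstance : Fintype ι)
  let M : ∀ b, Matrix (κ b) (κ b) ℝ := fun b => match b with
    | true => Y
    | false => X
  have h := evalOn_blockDiagonal' hf ha M
  rw [Fintype.sum_bool, add_comm] at h
  refine Eq.trans ?_ h
  rw [← evalOn_submatrix hf (Equiv.sumEquivSigmaBool ι ι')]
  congr 1
  ext (i | i) (j | j)
  · exact (Matrix.blockDiagonal'_apply_eq M false _ _).symm
  · exact (Matrix.blockDiagonal'_apply_ne M (k := false) (k' := true) i j Bool.false_ne_true).symm
  · exact (Matrix.blockDiagonal'_apply_ne M (k := true) (k' := false) i j Bool.false_ne_true.symm).symm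
  · exact (Matrix.blockDiagonal'_apply_eq M true _ _).symm

lemma evalOn_zero (hf : RelabellingInvariant f) (ha : DiagonallyBlockAdditive f)
    (ι : Type*) [Fintype ι] :
    evalOn f (0 : Matrix ι ι ℝ) = Fintype.card ι * evalOn f (0 : Matrix Unit Unit ℝ) := by
  classical
  have h := evalOn_blockDiagonal hf ha fun _ : ι => (0 : Matrix Unit Unit ℝ)
  rw [Finset.sum_const, Finset.card_univ, nsmul_eq_mul] at h
  rw [← h, ← evalOn_submatrix hf (Equiv.punitProd ι).symm]
  congr 1
  exact (Matrix.blockDiagonal_zero (m := Unit) (n := Unit) (o := ι) (α := ℝ)) ▸ rfl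

/-- The matrix with blocks `b, 0` (top) and `√γ diag z, 0` (bottom). -/
noncomputable def columnMatrix (γ : ℝ) {ι : Type*} [DecidableEq ι] (b : Matrix ι ι ℝ)
    (z : ι → Bool) : Matrix (ι ⊕ ι) (ι ⊕ ι) ℝ :=
  Matrix.fromBlocks b 0 (Matrix.diagonal fun i => if z i then Real.sqrt γ else 0) 0

variable {γ : ℝ}

lemma columnMatrix_submatrix {ι ι' : Type*} [DecidableEq ι] [DecidableEq ι'] (e : ι' ≃ ι)
    (b : Matrix ι ι ℝ) (z : ι → Bool) :
    (columnMatrix γ b z).submatrix (e.sumCongr e) (e.sumCongr e)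
      = columnMatrix γ (b.submatrix e e) (z ∘ e) := by
  ext (i | i) (j | j) <;> simp [columnMatrix, Matrix.diagonal_apply]

lemma evalOn_columnMatrix_equiv (hf : RelabellingInvariant f) {ι ι' : Type*} [Fintype ι]
    [Fintype ι'] [DecidableEq ι] [DecidableEq ι'] (e : ι' ≃ ι) (b : Matrix ι ι ℝ)
    (z : ι → Bool) : evalOn f (columnMatrix γ (b.submatrix e e) (z ∘ e))
      = evalOn f (columnMatrix γ b z) := by
  rw [← columnMatrix_submatrix, evalOn_submatrix hf]

lemma evalOn_columnMatrix_fromBlocks.{u} (hf : RelabellingInvariant f)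
    (ha : DiagonallyBlockAdditive f) {ι ι' : Type u} [Fintype ι] [Fintype ι'] [DecidableEq ι]
    [DecidableEq ι'] (b : Matrix ι ι ℝ) (b' : Matrix ι' ι' ℝ) (z : ι ⊕ ι' → Bool) :
    evalOn f (columnMatrix γ (Matrix.fromBlocks b 0 0 b') z)
      = evalOn f (columnMatrix γ b (z ∘ Sum.inl)) + evalOn f (columnMatrix γ b' (z ∘ Sum.inr)) := by
  rw [← evalOn_fromBlocks hf ha, ← evalOn_submatrix hf (Equiv.sumSumSumComm ι ι ι' ι')]
  congr 1
  ext ((i | i) | (i | i)) ((j | j) | (j | j)) <;> simp [columnMatrix, Matrix.diagonal_apply]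

lemma evalOn_columnMatrix_blockDiagonal (hf : RelabellingInvariant f)
    (ha : DiagonallyBlockAdditive f) {κ o : Type*} [Fintype κ] [Fintype o] [DecidableEq κ]
    [DecidableEq o] (b : o → Matrix κ κ ℝ) (z : κ × o → Bool) :
    evalOn f (columnMatrix γ (Matrix.blockDiagonal b) z)
      = ∑ k, evalOn f (columnMatrix γ (b k) fun i => z (i, k)) := by
  rw [← evalOn_blockDiagonal hf ha, ← evalOn_submatrix hf (Equiv.sumProdDistrib κ κ o)]
  congr 1
  ext ⟨i | i, k⟩ ⟨j | j, l⟩ <;>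
    by_cases hk : k = l <;>
    simp [columnMatrix, Matrix.diagonal_apply, Matrix.blockDiagonal_apply, hk]

lemma evalOn_columnMatrix_ones (hf : RelabellingInvariant f) {κ : Type*} [Fintype κ]
    [DecidableEq κ] {m : ℕ} (hκ : Fintype.card κ = m) (z : κ → Bool) :
    evalOn f (columnMatrix γ (Matrix.of fun _ _ => (1 : ℝ)) z)
      = f (m + m) (blockM γ m (Finset.univ.filter fun i => z i = true).card) := by
  set q := (Finset.univ.filter fun i => z i = true).card with hq
  set e₀ : Fin m ≃ κ := (Fintype.equivFinOfCardEq hκ).symm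
  have hqm : q ≤ m := by rw [← hκ]; exact Finset.card_le_univ _
  have hcard : Fintype.card {i : Fin m // (i : ℕ) < q} = Fintype.card {i : Fin m // z (e₀ i) = true} := by
    rw [Fintype.card_subtype, Fintype.card_subtype]
    have h1 : (Finset.univ.filter fun i : Fin m => (i : ℕ) < q).card = q := by
      rw [Fin.card_filter_val_lt, min_eq_right hqm]
    rw [h1, hq]
    refine (Finset.card_bij (fun i _ => e₀ i) ?_ ?_ ?_).symm
    · intro i hi; simpa using hi
    · intro i _ j _ h; exact e₀.injective h
    · intro i hi; exact ⟨e₀.symm i, by simpa using hi, by simp⟩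
  set π := (Fintype.equivOfCardEq hcard).extendSubtype
  have hπ : ∀ i : Fin m, z (e₀ (π i)) = decide ((i : ℕ) < q) := by
    intro i
    by_cases h : (i : ℕ) < q
    · simpa [h] using (Fintype.equivOfCardEq hcard).extendSubtype_mem i h
    · simpa [h] using (Fintype.equivOfCardEq hcard).extendSubtype_not_mem i h
  rw [← evalOn_columnMatrix_equiv hf (π.trans e₀), evalOn_eq hf finSumFinEquiv.symm]
  congr 1
  ext a b
  simp only [blockM, Matrix.reindex_apply, Matrix.submatrix_apply]
  generalize finSumFinEquiv.symm a = a'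
  generalize finSumFinEquiv.symm b = b'
  rcases a' with i | i <;> rcases b' with j | j <;>
    simp [columnMatrix, diagMat, Matrix.diagonal_apply, hπ]

end EvalOn

section Parity

variable {κ : Type*} [Fintype κ]

/-- The number of ones of a bit string. -/
def bitCount (y : κ → Bool) : ℕ := (Finset.univ.filter fun i => y i = true).card

lemma bitCount_le (y : κ → Bool) : bitCount y ≤ Fintype.card κ := Finset.card_le_univ _

lemma bitCount_not (y : κ → Bool) :
    bitCount (fun i => !y i) = Fintype.card κ - bitCount y := by
  have h := Finset.card_filter_add_card_filter_not (s := (Finset.univ : Finset κ))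
    fun i => y i = true
  have h2 : bitCount (fun i => !y i) = (Finset.univ.filter fun i => ¬ y i = true).card := by
    simp [bitCount]
  rw [Finset.card_univ] at h
  rw [h2, bitCount]
  omega

lemma bitParity_eq_decide_odd (y : κ → Bool) : bitParity y = decide (Odd (bitCount y)) := rfl

lemma bitParity_not (hκ : Even (Fintype.card κ)) (y : κ → Bool) :
    bitParity (fun i => !y i) = bitParity y := by
  rw [bitParity_eq_decide_odd, bitParity_eq_decide_odd, bitCount_not]
  congr 1
  rw [eq_iff_iff, Nat.odd_sub (bitCount_le y)]
  simp [Nat.not_odd_iff_even.2 hκ, ← Nat.not_odd_iff_even]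

lemma boolSign_injective : Function.Injective boolSign := by
  intro a b h
  cases a <;> cases b <;> simp [boolSign] at h ⊢ <;> norm_num at h

variable [DecidableEq κ]

lemma bitParity_flipAt (i : κ) (y : κ → Bool) : bitParity (flipAt i y) = !bitParity y := by
  apply boolSign_injective
  rw [boolSign_not, boolSign_bitParity, boolSign_bitParity]
  exact walsh_flipAt_of_mem (Finset.mem_univ i) y

lemma sum_apply_bitCount (g : ℕ → ℝ) :
    ∑ y : κ → Bool, g (bitCount y)
      = ∑ q ∈ Finset.range (Fintype.card κ + 1), (Fintype.card κ).choose q * g q := by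
  have h := Finset.sum_powerset_apply_card g (x := (Finset.univ : Finset κ))
  rw [Finset.powerset_univ, Finset.card_univ] at h
  simp only [nsmul_eq_mul] at h
  rw [← h]
  refine Finset.sum_bij' (fun y _ => Finset.univ.filter fun i => y i = true)
    (fun S _ i => decide (i ∈ S)) ?_ ?_ ?_ ?_ ?_ <;> simp [bitCount]

/-- The expectation over the even (`b = false`) or odd (`b = true`) binomial distribution. -/
noncomputable def parityExpectation (b : Bool) (t : ℕ) (F : ℕ → ℝ) : ℝ :=
  if b then oddExpectation t F else evenExpectation t F

lemma two_mul_expect_bitParity (hκ : 0 < Fintype.card κ) (b : Bool) (F : ℕ → ℝ) :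
    2 * (𝔼 y : κ → Bool, if bitParity y = b then F (bitCount y) else 0)
      = parityExpectation b (Fintype.card κ) F := by
  have h1 : ∀ y : κ → Bool, (if bitParity y = b then F (bitCount y) else 0)
      = (fun q => if decide (Odd q) = b then F q else 0) (bitCount y) := fun y => rfl
  rw [Fintype.expect_eq_sum_div_card, Finset.sum_congr rfl fun y _ => h1 y,
    sum_apply_bitCount fun q => if decide (Odd q) = b then F q else 0]
  obtain ⟨n, hn⟩ : ∃ n, Fintype.card κ = n + 1 := ⟨Fintype.card κ - 1, by omega⟩
  have h2 : ((Fintype.card (κ → Bool) : ℕ) : ℝ) = 2 * 2 ^ n := by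
    rw [Fintype.card_fun, Fintype.card_bool, hn]; push_cast; ring
  rw [h2, parityExpectation, oddExpectation, evenExpectation, hn, ← mul_div_assoc,
    mul_div_mul_left _ _ two_ne_zero, Finset.sum_div]
  cases b
  · simp only [decide_eq_false_iff_not, Nat.not_odd_iff_even, Bool.false_eq_true, if_false,
      Finset.sum_filter]
    refine Finset.sum_congr rfl fun q _ => ?_
    split_ifs <;> simp [parityBinomialDensity]; ring
  · simp only [decide_eq_true_iff, if_true, Finset.sum_filter]
    refine Finset.sum_congr rfl fun q _ => ?_
    split_ifs <;> simp [parityBinomialDensity]; ring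

/-- Flip a coordinate of a bit string if its parity is not `b`. -/
def repairParity (b : Bool) (i : κ) (y : κ → Bool) : κ → Bool :=
  if (xor (bitParity y) b) = true then flipAt i y else y

lemma expect_repairParity (b : Bool) (i : κ) (H : (κ → Bool) → ℝ) :
    𝔼 y, H (repairParity b i y) = 2 * 𝔼 y, if bitParity y = b then H y else 0 := by
  have h1 : ∀ y, H (repairParity b i y) = (if bitParity y = b then H y else 0)
      + if bitParity (flipAt i y) = b then H (flipAt i y) else 0 := by
    intro y
    rw [repairParity, bitParity_flipAt]
    cases bitParity y <;> cases b <;> simp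
  simp only [h1]
  rw [Finset.expect_add_distrib,
    expect_flipAt i fun y => if bitParity y = b then H y else 0]
  ring

/-- The sum of `F` over the numbers of ones of a bit string and of its complement. -/
def pairValue (F : ℕ → ℝ) (y : κ → Bool) : ℝ := F (bitCount y) + F (bitCount fun i => !y i)

lemma expect_pairValue_repairParity (hκ : 0 < Fintype.card κ) (hκ2 : Even (Fintype.card κ))
    (b : Bool) (i : κ) (F : ℕ → ℝ) :
    𝔼 y, pairValue F (repairParity b i y) = 2 * parityExpectation b (Fintype.card κ) F := by
  have hnot : (𝔼 y : κ → Bool, if bitParity y = b then F (bitCount fun i => !y i) else 0)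
      = 𝔼 y : κ → Bool, if bitParity y = b then F (bitCount y) else 0 := by
    have hinv : Function.Involutive fun (y : κ → Bool) i => !y i := fun y => by ext; simp
    refine Fintype.expect_equiv hinv.toPerm _ _ fun y => ?_
    change _ = if bitParity (fun i => !y i) = b then F (bitCount fun i => !y i) else 0
    rw [bitParity_not hκ2]
  have hadd : (𝔼 y : κ → Bool, if bitParity y = b then pairValue F y else 0)
      = (𝔼 y : κ → Bool, if bitParity y = b then F (bitCount y) else 0)
        + 𝔼 y : κ → Bool, if bitParity y = b then F (bitCount fun i => !y i) else 0 := by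
    rw [← Finset.expect_add_distrib]
    refine Finset.expect_congr rfl fun y _ => ?_
    rw [pairValue]
    split_ifs <;> simp
  rw [expect_repairParity b i, hadd, hnot, ← two_mul_expect_bitParity hκ]
  ring

end Parity

section Chebyshev

variable {V E κ : Type*} [Fintype V] [DecidableEq V] [Fintype κ] [DecidableEq κ]

lemma expect_mul_eq_zero_of_disjoint_blocks (emb : E × κ ↪ V) (φ : (κ → Bool) → ℝ)
    (hφ : 𝔼 y, φ y = 0) {e e' : E} (h : e ≠ e') :
    𝔼 x : V → Bool, φ (fun i => x (emb (e, i))) * φ (fun i => x (emb (e', i))) = 0 := by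
  have hinj : Function.Injective fun i => emb (e, i) := fun i j hij => by
    simpa using emb.injective hij
  set s : (κ → Bool) → V → Bool := fun u =>
    Function.extend (fun i => emb (e, i)) u fun _ => false with hs
  have h1 : ∀ u i, s u (emb (e, i)) = u i := fun u i => hinj.extend_apply u _ i
  have h2 : ∀ u i, s u (emb (e', i)) = false := fun u i =>
    Function.extend_apply' _ _ _ fun ⟨j, hj⟩ => h (by simpa using congrArg Prod.fst (emb.injective hj))
  have hshift : ∀ u : κ → Bool, (𝔼 x : V → Bool, φ (fun i => x (emb (e, i))) * φ (fun i => x (emb (e', i))))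
      = 𝔼 x : V → Bool, φ (fun i => xor (x (emb (e, i))) (u i)) * φ (fun i => x (emb (e', i))) := by
    intro u
    have hinv : Function.Involutive fun (x : V → Bool) v => xor (x v) (s u v) :=
      fun x => by ext v; simp
    refine (Fintype.expect_equiv hinv.toPerm _ _ fun x => ?_).symm
    change _ = φ (fun i => xor (x (emb (e, i))) (s u (emb (e, i))))
      * φ (fun i => xor (x (emb (e', i))) (s u (emb (e', i))))
    simp only [h1, h2, Bool.xor_false]
  have hzero : ∀ z : κ → Bool, (𝔼 u : κ → Bool, φ fun i => xor (z i) (u i)) = 0 := by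
    intro z
    rw [← hφ]
    have hinv : Function.Involutive fun (u : κ → Bool) i => xor (z i) (u i) :=
      fun x => by ext v; simp
    exact Fintype.expect_equiv hinv.toPerm _ _ fun u => rfl
  calc (𝔼 x : V → Bool, φ (fun i => x (emb (e, i))) * φ (fun i => x (emb (e', i))))
      = 𝔼 _u : κ → Bool, 𝔼 x : V → Bool,
          φ (fun i => x (emb (e, i))) * φ (fun i => x (emb (e', i))) :=
        (Fintype.expect_const _).symm
    _ = 𝔼 u : κ → Bool, 𝔼 x : V → Bool,
          φ (fun i => xor (x (emb (e, i))) (u i)) * φ (fun i => x (emb (e', i))) :=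
        Finset.expect_congr rfl fun u _ => hshift u
    _ = 𝔼 x : V → Bool, 𝔼 u : κ → Bool,
          φ (fun i => xor (x (emb (e, i))) (u i)) * φ (fun i => x (emb (e', i))) :=
        Finset.expect_comm _ _ _
    _ = 0 := by
        simp only [← Finset.expect_mul, hzero, zero_mul, Finset.expect_const_zero]

variable [Fintype E]

lemma expect_sum_blocks_sq_le (emb : E × κ ↪ V) (φ : (κ → Bool) → ℝ) (hφ : 𝔼 y, φ y = 0)
    {C : ℝ} (hC : ∀ y, |φ y| ≤ C) :
    𝔼 x : V → Bool, (∑ e, φ fun i => x (emb (e, i))) ^ 2 ≤ Fintype.card E * C ^ 2 := by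
  classical
  simp only [sq (∑ _e : E, _), Finset.sum_mul_sum]
  rw [Finset.expect_sum_comm]
  calc _ ≤ ∑ _e : E, C ^ 2 := by
        refine Finset.sum_le_sum fun e _ => ?_
        rw [Finset.expect_sum_comm, Finset.sum_eq_single e]
        · refine Finset.expect_le Finset.univ_nonempty fun x _ => ?_
          rw [← sq, ← sq_abs]
          exact pow_le_pow_left₀ (abs_nonneg _) (hC _) 2
        · intro e' _ he'
          exact expect_mul_eq_zero_of_disjoint_blocks emb φ hφ he'.symm
        · simp
    _ = _ := by simp

/-- Chebyshev's inequality for a sum over disjoint blocks of coordinates. -/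
lemma expect_deviation_le (emb : E × κ ↪ V) (φ : (κ → Bool) → ℝ) (hφ : 𝔼 y, φ y = 0)
    {C r : ℝ} (hC : ∀ y, |φ y| ≤ C) (hr : 0 < r) :
    (𝔼 x : V → Bool, if r < |∑ e, φ fun i => x (emb (e, i))| then (1 : ℝ) else 0)
      ≤ Fintype.card E * C ^ 2 / r ^ 2 := by
  refine le_trans ?_ (div_le_div_of_nonneg_right (expect_sum_blocks_sq_le emb φ hφ hC)
    (sq_nonneg r))
  rw [Finset.expect_div]
  refine Finset.expect_le_expect fun x _ => ?_
  split_ifs with h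
  · rw [one_le_div (by positivity), ← sq_abs (∑ e, _)]
    exact pow_le_pow_left₀ hr.le h.le 2
  · positivity

end Chebyshev

section Averaging

/-- Some point lies in at most the average measure of finitely many sets, which need not be
measurable. -/
lemma exists_expect_mem_le {Ω ι : Type*} [MeasurableSpace Ω] (μ : Measure Ω)
    [IsProbabilityMeasure μ] [Fintype ι] [Nonempty ι] (s : ι → Set Ω) {δ : ℝ}
    (hs : ∀ i, μ.real (s i) ≤ δ) :
    ∃ ω, (𝔼 i, (s i).indicator (fun _ => (1 : ℝ)) ω) ≤ δ := by
  set T : ι → Set Ω := fun i => toMeasurable μ (s i)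
  have hT : ∀ i, MeasurableSet (T i) := fun i => measurableSet_toMeasurable μ _
  have hint : ∀ i, Integrable ((T i).indicator fun _ => (1 : ℝ)) μ := fun i =>
    (integrable_const 1).indicator (hT i)
  have hsum : Integrable (fun ω => ∑ i, (T i).indicator (fun _ => (1 : ℝ)) ω) μ :=
    integrable_finsetSum _ fun i _ => hint i
  obtain ⟨ω, hω⟩ := exists_le_integral hsum
  refine ⟨ω, ?_⟩
  rw [integral_finsetSum _ fun i _ => hint i] at hω
  have h1 : ∀ i, ∫ ω, (T i).indicator (fun _ => (1 : ℝ)) ω ∂μ ≤ δ := by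
    intro i
    rw [integral_indicator_const _ (hT i), smul_eq_mul, mul_one]
    refine le_trans (le_of_eq ?_) (hs i)
    rw [Measure.real, Measure.real, measure_toMeasurable]
  have h2 : ∑ i, (s i).indicator (fun _ => (1 : ℝ)) ω ≤ Fintype.card ι * δ := by
    calc _ ≤ ∑ i, (T i).indicator (fun _ => (1 : ℝ)) ω :=
          Finset.sum_le_sum fun i _ => Set.indicator_le_indicator_of_subset
            (subset_toMeasurable μ _) (fun _ => zero_le_one) ω
      _ ≤ _ := hω
      _ ≤ ∑ _i : ι, δ := Finset.sum_le_sum fun i _ => h1 i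
      _ = _ := by simp
  rw [Fintype.expect_eq_sum_div_card, div_le_iff₀ (by exact_mod_cast Fintype.card_pos)]
  linarith

end Averaging

section Streams

variable {N : ℕ}

/-- A stream that builds the matrix `X` and touches exactly its nonzero entries. -/
noncomputable def entryStream (X : Matrix (Fin N) (Fin N) ℝ) : List (Update N) :=
  ((Finset.univ : Finset (Fin N × Fin N)).filter fun p => X p.1 p.2 ≠ 0).toList.map
    fun p => ⟨p.1, p.2, X p.1 p.2⟩

lemma streamMatrix_append (s s' : List (Update N)) :
    streamMatrix (s ++ s') = streamMatrix s + streamMatrix s' := by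
  simp [streamMatrix]

lemma streamMatrix_entryStream (X : Matrix (Fin N) (Fin N) ℝ) :
    streamMatrix (entryStream X) = X := by
  have h : streamMatrix (entryStream X) = ∑ p : Fin N × Fin N, Matrix.single p.1 p.2 (X p.1 p.2) := by
    rw [streamMatrix, entryStream, List.map_map]
    change (List.map (fun p : Fin N × Fin N => Matrix.single p.1 p.2 (X p.1 p.2)) _).sum = _
    rw [Finset.sum_map_toList, Finset.sum_filter]
    refine Finset.sum_congr rfl fun p _ => ?_
    split_ifs with hp
    · rfl
    · rw [not_not.1 hp, Matrix.single_zero]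
  rw [h, Fintype.sum_prod_type]
  exact (Matrix.matrix_eq_sum_single X).symm

lemma entryStream_positions (X : Matrix (Fin N) (Fin N) ℝ) :
    (entryStream X).map (fun u => (u.row, u.col))
      = ((Finset.univ : Finset (Fin N × Fin N)).filter fun p => X p.1 p.2 ≠ 0).toList := by
  rw [entryStream, List.map_map]
  exact List.map_id _

lemma entryStream_append_mem {X Y : Matrix (Fin N) (Fin N) ℝ} {U : Set ℝ}
    (hX : ∀ i j, X i j ≠ 0 → X i j ∈ U) (hY : ∀ i j, Y i j ≠ 0 → Y i j ∈ U)
    (hXY : ∀ i j, X i j ≠ 0 → Y i j = 0) :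
    entryStream X ++ entryStream Y ∈ insertionStreams N U := by
  constructor
  · rw [List.map_append, entryStream_positions, entryStream_positions]
    refine (Finset.nodup_toList _).append (Finset.nodup_toList _) fun p hp hq => ?_
    simp only [Finset.mem_toList, Finset.mem_filter, Finset.mem_univ, true_and] at hp hq
    exact hq (hXY _ _ hp)
  · intro u hu
    rw [List.mem_append] at hu
    rcases hu with hu | hu <;>
    · simp only [entryStream, List.mem_map, Finset.mem_toList, Finset.mem_filter, Finset.mem_univ,
        true_and] at hu
      obtain ⟨p, hp, rfl⟩ := hu
      first
      | exact hX _ _ hp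
      | exact hY _ _ hp

end Streams

section Construction

/-- The variables of the hidden hypermatching instance: the vertices of `B` hyperedges of size `t`
and unmatched vertices. -/
abbrev HypermatchingVar (t B : ℕ) : Type := (Fin B × Fin t) ⊕ Fin (63 * t * B)

lemma card_hypermatchingVar (t B : ℕ) : Fintype.card (HypermatchingVar t B) = 64 * t * B := by
  simp only [Fintype.card_sum, Fintype.card_prod, Fintype.card_fin]
  ring

/-- The columns of the hard matrices: the literals of the variables and the padding of the
blocks. -/
abbrev HardPoint (t d B : ℕ) : Type :=
  (HypermatchingVar t B × Bool) ⊕ ((Fin B × Bool) × Fin d)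

/-- The columns of the hard matrices, grouped by blocks. -/
abbrev BlockPoint (t d B : ℕ) : Type :=
  ((Fin t ⊕ Fin d) × (Fin B × Bool)) ⊕ (Unit × (Fin (63 * t * B) × Bool))

/-- The index set of the hard matrices. -/
abbrev HardIndex (t d B R : ℕ) : Type := (HardPoint t d B ⊕ HardPoint t d B) ⊕ Fin R

variable {t d B R : ℕ}

lemma card_hardIndex : Fintype.card (HardIndex t d B R) = (256 * t + 4 * d) * B + R := by
  simp only [Fintype.card_sum, Fintype.card_prod, Fintype.card_fin, Fintype.card_bool]
  ring

/-- The two groupings of the columns. -/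
def blockPointEquiv (t d B : ℕ) : BlockPoint t d B ≃ HardPoint t d B where
  toFun
    | .inl (.inl i, (l, β)) => .inl (.inl (l, i), β)
    | .inl (.inr j, o) => .inr (o, j)
    | .inr ((), (v, β)) => .inl (.inr v, β)
  invFun
    | .inl (.inl (l, i), β) => .inl (.inl i, (l, β))
    | .inr (o, j) => .inl (.inr j, o)
    | .inl (.inr v, β) => .inr ((), (v, β))
  left_inv := by rintro (⟨i | j, ⟨l, β⟩⟩ | ⟨⟨⟩, ⟨v, β⟩⟩) <;> rfl
  right_inv := by rintro (⟨⟨l, i⟩ | v, β⟩ | ⟨o, j⟩) <;> rfl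

/-- Whether the literals of a variable are exchanged: this happens at the vertex `i₀` of the
hyperedges marked by `w`. -/
def twist (i₀ : Fin t) (w : Fin B → Bool) : HypermatchingVar t B → Bool
  | .inl (l, i) => w l && decide (i = i₀)
  | .inr _ => false

/-- The placement of the hypermatching on the literals. -/
def literalPerm (i₀ : Fin t) (σ : Equiv.Perm (HypermatchingVar t B)) (w : Fin B → Bool) :
    Equiv.Perm (HypermatchingVar t B × Bool) where
  toFun p := (σ p.1, xor p.2 (twist i₀ w p.1))
  invFun p := (σ.symm p.1, xor p.2 (twist i₀ w (σ.symm p.1)))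
  left_inv p := by simp
  right_inv p := by simp

/-- The placement of the blocks of the hard matrix. -/
def blockPlacement (d : ℕ) (i₀ : Fin t) (σ : Equiv.Perm (HypermatchingVar t B))
    (w : Fin B → Bool) : BlockPoint t d B ≃ HardPoint t d B :=
  (blockPointEquiv t d B).trans ((literalPerm i₀ σ w).sumCongr (Equiv.refl _))

/-- The all-ones blocks. -/
def onesMatrix (t d B : ℕ) : Matrix (BlockPoint t d B) (BlockPoint t d B) ℝ :=
  Matrix.fromBlocks (Matrix.blockDiagonal fun _ => Matrix.of fun _ _ => 1) 0 0
    (Matrix.blockDiagonal fun _ => 0)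

/-- The bit of each column: the truth values of the literals. -/
def literalBit (x : HypermatchingVar t B → Bool) : HardPoint t d B → Bool
  | .inl (v, β) => xor (x v) β
  | .inr _ => false

/-- The part of the hard matrix that encodes the assignment `x`. -/
noncomputable def assignmentMatrix (γ : ℝ) (d R : ℕ) (x : HypermatchingVar t B → Bool) :
    Matrix (HardIndex t d B R) (HardIndex t d B R) ℝ :=
  Matrix.fromBlocks (columnMatrix γ 0 (literalBit x)) 0 0 0

/-- The part of the hard matrix that encodes the hypermatching. -/
noncomputable def hypermatchingMatrix (d R : ℕ) (i₀ : Fin t)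
    (σ : Equiv.Perm (HypermatchingVar t B)) (w : Fin B → Bool) :
    Matrix (HardIndex t d B R) (HardIndex t d B R) ℝ :=
  Matrix.fromBlocks (Matrix.fromBlocks ((onesMatrix t d B).submatrix
    (blockPlacement d i₀ σ w).symm (blockPlacement d i₀ σ w).symm) 0 0 0) 0 0 0

lemma assignmentMatrix_add_hypermatchingMatrix (γ : ℝ) (i₀ : Fin t)
    (x : HypermatchingVar t B → Bool) (σ : Equiv.Perm (HypermatchingVar t B))
    (w : Fin B → Bool) :
    assignmentMatrix γ d R x + hypermatchingMatrix d R i₀ σ w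
      = Matrix.fromBlocks (columnMatrix γ ((onesMatrix t d B).submatrix
          (blockPlacement d i₀ σ w).symm (blockPlacement d i₀ σ w).symm) (literalBit x)) 0 0 0 := by
  simp [assignmentMatrix, hypermatchingMatrix, columnMatrix, Matrix.fromBlocks_add]

lemma assignmentMatrix_entry (γ : ℝ) (x : HypermatchingVar t B → Bool)
    (a b : HardIndex t d B R) (h : assignmentMatrix γ d R x a b ≠ 0) :
    assignmentMatrix γ d R x a b = Real.sqrt γ := by
  rcases a with (a | a) | a <;> rcases b with (b | b) | b <;>
    simp [assignmentMatrix, columnMatrix, Matrix.diagonal_apply] at h ⊢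
  obtain ⟨rfl, h1, -⟩ := h
  simp [h1]

lemma onesMatrix_entry (a b : BlockPoint t d B) (h : onesMatrix t d B a b ≠ 0) :
    onesMatrix t d B a b = 1 := by
  rcases a with ⟨a, o⟩ | ⟨a, o⟩ <;> rcases b with ⟨b, o'⟩ | ⟨b, o'⟩ <;>
    simp [onesMatrix, Matrix.blockDiagonal_apply] at h ⊢
  simp [h]

lemma hypermatchingMatrix_entry (i₀ : Fin t) (σ : Equiv.Perm (HypermatchingVar t B))
    (w : Fin B → Bool) (a b : HardIndex t d B R) (h : hypermatchingMatrix d R i₀ σ w a b ≠ 0) :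
    hypermatchingMatrix d R i₀ σ w a b = 1 := by
  rcases a with (a | a) | a <;> rcases b with (b | b) | b <;>
    simp only [hypermatchingMatrix, Matrix.fromBlocks_apply₁₁, Matrix.fromBlocks_apply₁₂,
      Matrix.fromBlocks_apply₂₁, Matrix.fromBlocks_apply₂₂, Matrix.zero_apply, ne_eq,
      not_true_eq_false] at h ⊢
  exact onesMatrix_entry _ _ h

lemma hypermatchingMatrix_eq_zero (γ : ℝ) (i₀ : Fin t) (x : HypermatchingVar t B → Bool)
    (σ : Equiv.Perm (HypermatchingVar t B)) (w : Fin B → Bool) (a b : HardIndex t d B R)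
    (h : assignmentMatrix γ d R x a b ≠ 0) : hypermatchingMatrix d R i₀ σ w a b = 0 := by
  rcases a with (a | a) | a <;> rcases b with (b | b) | b <;>
    simp [assignmentMatrix, columnMatrix, hypermatchingMatrix] at h ⊢

variable {f : SquareMatrixFunction} {γ : ℝ}

lemma bitCount_sum {κ κ' : Type*} [Fintype κ] [Fintype κ'] (y : κ ⊕ κ' → Bool) :
    bitCount y = bitCount (y ∘ Sum.inl) + bitCount (y ∘ Sum.inr) := by
  simp only [bitCount, Finset.card_filter, Fintype.sum_sum_type, Function.comp_apply]

lemma bitCount_block (i₀ : Fin t) (x : HypermatchingVar t B → Bool)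
    (σ : Equiv.Perm (HypermatchingVar t B)) (w : Fin B → Bool) (l : Fin B) (β : Bool) :
    bitCount (fun i => literalBit x (blockPlacement d i₀ σ w (Sum.inl (i, (l, β)))))
      = bitCount fun i => xor ((if w l = true then flipAt i₀ (fun i => x (σ (Sum.inl (l, i))))
          else fun i => x (σ (Sum.inl (l, i)))) i) β := by
  have hpad : bitCount ((fun i => literalBit x (blockPlacement d i₀ σ w (Sum.inl (i, (l, β)))))
      ∘ Sum.inr) = 0 := by
    simp [bitCount, blockPlacement, blockPointEquiv, literalBit]
  rw [bitCount_sum, hpad, add_zero]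
  congr 1
  ext i
  change xor (x (σ (Sum.inl (l, i)))) (xor β (w l && decide (i = i₀))) = _
  by_cases hw : w l = true <;> by_cases hi : i = i₀
  · subst hi
    simp [hw, flipAt_self, Bool.xor_comm]
  · simp [hw, hi, flipAt_of_ne hi]
  · simp [hw]
  · simp [hw]

/-- The contribution of an unmatched literal to the value of `f`. -/
noncomputable def singleValue (f : SquareMatrixFunction) (γ : ℝ) (b : Bool) : ℝ :=
  evalOn f (columnMatrix γ (0 : Matrix Unit Unit ℝ) fun _ => b)

/-- The part of the value of `f` on the hard matrices that does not depend on the instance. -/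
noncomputable def offsetValue (f : SquareMatrixFunction) (γ : ℝ) (t B R : ℕ) : ℝ :=
  (63 * t * B : ℕ) * (singleValue f γ true + singleValue f γ false)
    + R * evalOn f (0 : Matrix Unit Unit ℝ)

lemma evalOn_hardMatrix (hf : RelabellingInvariant f) (ha : DiagonallyBlockAdditive f)
    {m : ℕ} (hm : t + d = m) (i₀ : Fin t)
    (x : HypermatchingVar t B → Bool) (σ : Equiv.Perm (HypermatchingVar t B))
    (w : Fin B → Bool) :
    evalOn f (assignmentMatrix γ d R x + hypermatchingMatrix d R i₀ σ w)
      = ∑ l, pairValue (fun q => f (m + m) (blockM γ m q))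
          (if w l = true then flipAt i₀ (fun i => x (σ (Sum.inl (l, i))))
            else fun i => x (σ (Sum.inl (l, i)))) + offsetValue f γ t B R := by
  have h0 := evalOn_columnMatrix_equiv (γ := γ) hf (blockPlacement d i₀ σ w)
    ((onesMatrix t d B).submatrix (blockPlacement d i₀ σ w).symm (blockPlacement d i₀ σ w).symm)
    (literalBit x)
  rw [Matrix.submatrix_submatrix, Equiv.symm_comp_self, Matrix.submatrix_id_id] at h0
  rw [assignmentMatrix_add_hypermatchingMatrix, evalOn_fromBlocks hf ha, evalOn_zero hf ha,
    Fintype.card_fin, ← h0, onesMatrix, evalOn_columnMatrix_fromBlocks hf ha,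
    evalOn_columnMatrix_blockDiagonal hf ha, evalOn_columnMatrix_blockDiagonal hf ha, offsetValue,
    ← add_assoc]
  congr 2
  · rw [Fintype.sum_prod_type]
    refine Finset.sum_congr rfl fun l _ => ?_
    have hcard : Fintype.card (Fin t ⊕ Fin d) = m := by simp [hm]
    have hb : ∀ β, evalOn f (columnMatrix γ (Matrix.of fun _ _ => (1 : ℝ))
        fun i => ((literalBit x ∘ blockPlacement d i₀ σ w) ∘ Sum.inl) (i, (l, β)))
        = f (m + m) (blockM γ m (bitCount fun i =>
          literalBit x (blockPlacement d i₀ σ w (Sum.inl (i, (l, β)))))) := fun β =>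
      evalOn_columnMatrix_ones hf hcard _
    rw [Fintype.sum_bool, hb, hb, bitCount_block, bitCount_block, add_comm]
    simp [pairValue]
  · rw [Fintype.sum_prod_type]
    have hv : ∀ v : Fin (63 * t * B), ∑ β : Bool, evalOn f (columnMatrix γ (0 : Matrix Unit Unit ℝ)
        fun i => ((literalBit x ∘ blockPlacement d i₀ σ w) ∘ Sum.inr) (i, (v, β)))
        = singleValue f γ true + singleValue f γ false := by
      intro v
      have hb : ∀ β, evalOn f (columnMatrix γ (0 : Matrix Unit Unit ℝ)
          fun i => ((literalBit x ∘ blockPlacement d i₀ σ w) ∘ Sum.inr) (i, (v, β)))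
          = singleValue f γ (xor (x (σ (Sum.inr v))) β) := by
        intro β
        rw [singleValue]
        congr 2
        ext i
        change xor (x (σ (Sum.inr v))) (xor β false) = _
        simp
      rw [Fintype.sum_bool, hb, hb]
      cases x (σ (Sum.inr v)) <;> simp [add_comm]
    rw [Finset.sum_congr rfl fun v _ => hv v, Finset.sum_const, Finset.card_univ,
      Fintype.card_fin, nsmul_eq_mul]

end Construction

section Protocol

variable {t d B R N S : ℕ}

/-- The part of the hard stream that encodes the assignment. -/
noncomputable def assignmentStream (γ : ℝ) (e : Fin N ≃ HardIndex t d B R)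
    (x : HypermatchingVar t B → Bool) : List (Update N) :=
  entryStream ((assignmentMatrix γ d R x).submatrix e e)

/-- The part of the hard stream that encodes the hypermatching. -/
noncomputable def hypermatchingStream (e : Fin N ≃ HardIndex t d B R) (i₀ : Fin t)
    (σ : Equiv.Perm (HypermatchingVar t B)) (w : Fin B → Bool) : List (Update N) :=
  entryStream ((hypermatchingMatrix d R i₀ σ w).submatrix e e)

/-- The parities of the matched hyperedges, shifted by the hidden bit `b`. -/
def shiftedParity (σ : Equiv.Perm (HypermatchingVar t B)) (x : HypermatchingVar t B → Bool)
    (b : Bool) : Fin B → Bool :=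
  fun l => xor (edgeParity Function.Embedding.inl σ x l) b

/-- The hard stream with hidden bit `b`. -/
noncomputable def hardStream (γ : ℝ) (e : Fin N ≃ HardIndex t d B R) (i₀ : Fin t)
    (σ : Equiv.Perm (HypermatchingVar t B)) (x : HypermatchingVar t B → Bool) (b : Bool) :
    List (Update N) :=
  assignmentStream γ e x ++ hypermatchingStream e i₀ σ (shiftedParity σ x b)

lemma hardStream_mem (γ : ℝ) (e : Fin N ≃ HardIndex t d B R) (i₀ : Fin t)
    (σ : Equiv.Perm (HypermatchingVar t B)) (x : HypermatchingVar t B → Bool) (b : Bool) :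
    hardStream γ e i₀ σ x b ∈ insertionStreams N {1, Real.sqrt γ} :=
  entryStream_append_mem (fun _ _ h => Or.inr (assignmentMatrix_entry γ x _ _ h))
    (fun _ _ h => Or.inl (hypermatchingMatrix_entry i₀ σ _ _ _ h))
    fun _ _ h => hypermatchingMatrix_eq_zero γ i₀ x σ _ _ _ h

variable {f : SquareMatrixFunction} {γ : ℝ}

lemma value_hardStream (hf : RelabellingInvariant f) (ha : DiagonallyBlockAdditive f)
    {m : ℕ} (hm : t + d = m) (e : Fin N ≃ HardIndex t d B R) (i₀ : Fin t)
    (σ : Equiv.Perm (HypermatchingVar t B)) (x : HypermatchingVar t B → Bool) (b : Bool) :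
    f N (streamMatrix (hardStream γ e i₀ σ x b))
      = ∑ l, pairValue (fun q => f (m + m) (blockM γ m q))
          (repairParity b i₀ fun i => x (σ (Sum.inl (l, i)))) + offsetValue f γ t B R := by
  have hadd : ∀ X Y : Matrix (HardIndex t d B R) (HardIndex t d B R) ℝ,
      X.submatrix e e + Y.submatrix e e = (X + Y).submatrix e e := fun _ _ => rfl
  rw [hardStream, streamMatrix_append, assignmentStream, hypermatchingStream,
    streamMatrix_entryStream, streamMatrix_entryStream, hadd, ← evalOn_eq hf,
    evalOn_hardMatrix hf ha hm]
  rfl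

/-- The advantage of the protocol that runs a good deterministic algorithm on the hard streams. -/
theorem le_advantage (hf : RelabellingInvariant f) (ha : DiagonallyBlockAdditive f)
    {m : ℕ} (hm : t + d = m) (ht : Even t) (ht0 : 0 < t) (hB : 0 < B)
    (e : Fin N ≃ HardIndex t d B R) (i₀ : Fin t)
    {c M C Δ δ : ℝ} (hc : 0 ≤ c) (hΔ : 0 < Δ)
    (hM : ∀ q ≤ t, |f (m + m) (blockM γ m q)| ≤ M)
    (hgap : |parityExpectation false t (fun q => f (m + m) (blockM γ m q))
      - parityExpectation true t (fun q => f (m + m) (blockM γ m q))| = Δ)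
    (hC : 2 * M * B + |offsetValue f γ t B R| ≤ C * B) (hcC : c * C ≤ Δ / 2)
    (A : StreamingAlgorithm N S)
    (hA : (𝔼 p : (Equiv.Perm (HypermatchingVar t B) × (HypermatchingVar t B → Bool)) × Bool,
      if ¬ |A.run (hardStream γ e i₀ p.1.1 p.1.2 p.2)
          - f N (streamMatrix (hardStream γ e i₀ p.1.1 p.1.2 p.2))|
        ≤ c * |f N (streamMatrix (hardStream γ e i₀ p.1.1 p.1.2 p.2))| then (1 : ℝ) else 0) ≤ δ) :
    ∃ G : (Fin S → Bool) → Equiv.Perm (HypermatchingVar t B) → (Fin B → Bool) → ℝ,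
      (∀ a σ w, 0 ≤ G a σ w) ∧ (∀ a σ w, G a σ w ≤ 1) ∧
      1 - 2 * δ - 2 * (B * (4 * M) ^ 2 / (Δ / 4 * B) ^ 2)
        ≤ 𝔼 σ : Equiv.Perm (HypermatchingVar t B), 𝔼 x,
          (G ((assignmentStream γ e x).foldl A.step A.init) σ
              (edgeParity Function.Embedding.inl σ x)
            - G ((assignmentStream γ e x).foldl A.step A.init) σ
              fun l => !edgeParity Function.Embedding.inl σ x l) := by
  set F : ℕ → ℝ := fun q => f (m + m) (blockM γ m q) with hF
  set off := offsetValue f γ t B R with hoff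
  set val : Bool → Equiv.Perm (HypermatchingVar t B) → (HypermatchingVar t B → Bool) → ℝ :=
    fun b σ x => f N (streamMatrix (hardStream γ e i₀ σ x b)) with hval
  set center : Bool → ℝ := fun b => B * (2 * parityExpectation b t F) + off with hcenter
  set φ : Bool → (Fin t → Bool) → ℝ := fun b y =>
    pairValue F (repairParity b i₀ y) - 2 * parityExpectation b t F with hφ
  set bad : Bool → Equiv.Perm (HypermatchingVar t B) → (HypermatchingVar t B → Bool) → ℝ :=
    fun b σ x => if ¬ |A.run (hardStream γ e i₀ σ x b) - val b σ x| ≤ c * |val b σ x|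
      then (1 : ℝ) else 0 with hbad
  set dev : Bool → Equiv.Perm (HypermatchingVar t B) → (HypermatchingVar t B → Bool) → ℝ :=
    fun b σ x => if Δ / 4 * B < |∑ l, φ b fun i => x (σ (Sum.inl (l, i)))|
      then (1 : ℝ) else 0 with hdev
  set G : (Fin S → Bool) → Equiv.Perm (HypermatchingVar t B) → (Fin B → Bool) → ℝ :=
    fun a σ w => if |A.output ((hypermatchingStream e i₀ σ w).foldl A.step a) - center false|
      < Δ * B then 1 else 0 with hG
  have hB' : (0 : ℝ) < B := by exact_mod_cast hB
  have hpair : ∀ y : Fin t → Bool, |pairValue F y| ≤ 2 * M := by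
    intro y
    have hle : ∀ z : Fin t → Bool, |F (bitCount z)| ≤ M := fun z =>
      hM _ (by simpa using bitCount_le z)
    calc |pairValue F y| ≤ |F (bitCount y)| + |F (bitCount fun i => !y i)| := abs_add_le _ _
      _ ≤ 2 * M := by linarith [hle y, hle fun i => !y i]
  have hexp : ∀ b, (𝔼 y : Fin t → Bool, pairValue F (repairParity b i₀ y))
      = 2 * parityExpectation b t F := by
    intro b
    have := expect_pairValue_repairParity (κ := Fin t) (by simpa using ht0) (by simpa using ht)
      b i₀ F
    simpa using this
  have hexp_le : ∀ b, |2 * parityExpectation b t F| ≤ 2 * M := by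
    intro b
    rw [← hexp b, abs_le]
    exact ⟨Finset.le_expect Finset.univ_nonempty fun y _ => (abs_le.1 (hpair _)).1,
      Finset.expect_le Finset.univ_nonempty fun y _ => (abs_le.1 (hpair _)).2⟩
  have hφ0 : ∀ b, 𝔼 y, φ b y = 0 := by
    intro b
    simp only [hφ]
    rw [Finset.expect_sub_distrib, hexp b, Fintype.expect_const, sub_self]
  have hφM : ∀ b y, |φ b y| ≤ 4 * M := by
    intro b y
    have h1 := abs_sub (pairValue F (repairParity b i₀ y)) (2 * parityExpectation b t F)
    linarith [hpair (repairParity b i₀ y), hexp_le b]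
  have hval_eq : ∀ b σ x, val b σ x
      = ∑ l, pairValue F (repairParity b i₀ fun i => x (σ (Sum.inl (l, i)))) + off :=
    fun b σ x => value_hardStream hf ha hm e i₀ σ x b
  have hval_center : ∀ b σ x, val b σ x - center b = ∑ l, φ b fun i => x (σ (Sum.inl (l, i))) := by
    intro b σ x
    simp only [hval_eq, hcenter, hφ, Finset.sum_sub_distrib, Finset.sum_const, Finset.card_univ,
      Fintype.card_fin, nsmul_eq_mul]
    ring
  have hval_le : ∀ b σ x, |val b σ x| ≤ C * B := by
    intro b σ x
    rw [hval_eq]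
    refine (abs_add_le _ _).trans (le_trans (add_le_add_left ?_ _) hC)
    refine (Finset.abs_sum_le_sum_abs _ _).trans ?_
    calc _ ≤ ∑ _l : Fin B, 2 * M := Finset.sum_le_sum fun l _ => hpair _
      _ = _ := by simp; ring
  have hdev_le : ∀ b σ, (𝔼 x, dev b σ x) ≤ B * (4 * M) ^ 2 / (Δ / 4 * B) ^ 2 := by
    intro b σ
    have := expect_deviation_le (Function.Embedding.inl.trans σ.toEmbedding :
      Fin B × Fin t ↪ HypermatchingVar t B) (φ b) (hφ0 b) (hφM b)
      (by positivity : 0 < Δ / 4 * (B : ℝ))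
    rw [Fintype.card_fin] at this
    exact this
  have hnear : ∀ b σ x, bad b σ x = 0 → dev b σ x = 0 →
      |A.run (hardStream γ e i₀ σ x b) - center b| < Δ * B := by
    intro b σ x h1 h2
    have h1' : |A.run (hardStream γ e i₀ σ x b) - val b σ x| ≤ c * |val b σ x| := by
      by_contra hcon
      simp [hbad, hcon] at h1
    have h2' : |val b σ x - center b| ≤ Δ / 4 * B := by
      rw [hval_center]
      by_contra hcon
      simp [hdev, not_le.1 hcon] at h2
    have h3 := abs_sub_le (A.run (hardStream γ e i₀ σ x b)) (val b σ x) (center b)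
    have h4 : c * |val b σ x| ≤ Δ / 2 * B := by
      calc c * |val b σ x| ≤ c * (C * B) := mul_le_mul_of_nonneg_left (hval_le b σ x) hc
        _ = c * C * B := by ring
        _ ≤ _ := mul_le_mul_of_nonneg_right hcC hB'.le
    have : 0 < Δ * B := by positivity
    linarith
  have hcenters : |center false - center true| = 2 * (Δ * B) := by
    have : center false - center true
        = 2 * B * (parityExpectation false t F - parityExpectation true t F) := by
      simp only [hcenter]; ring
    rw [this, abs_mul, hgap, abs_of_pos (by positivity)]
    ring
  have hrun : ∀ b σ x, A.output ((hypermatchingStream e i₀ σ (shiftedParity σ x b)).foldl A.step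
      ((assignmentStream γ e x).foldl A.step A.init)) = A.run (hardStream γ e i₀ σ x b) := by
    intro b σ x
    rw [StreamingAlgorithm.run, hardStream, List.foldl_append]
  have hbad01 : ∀ b σ x, bad b σ x = 0 ∨ bad b σ x = 1 := by
    intro b σ x
    simp only [hbad]
    split_ifs <;> simp
  have hdev01 : ∀ b σ x, dev b σ x = 0 ∨ dev b σ x = 1 := by
    intro b σ x
    simp only [hdev]
    split_ifs <;> simp
  have hG0 : ∀ a σ w, 0 ≤ G a σ w := fun a σ w => by simp only [hG]; split_ifs <;> simp
  have hG1 : ∀ a σ w, G a σ w ≤ 1 := fun a σ w => by simp only [hG]; split_ifs <;> simp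
  have hGeq : ∀ b σ x, G ((assignmentStream γ e x).foldl A.step A.init) σ (shiftedParity σ x b)
      = if |A.run (hardStream γ e i₀ σ x b) - center false| < Δ * B then 1 else 0 := by
    intro b σ x
    simp only [hG, hrun]
  refine ⟨G, hG0, hG1, ?_⟩
  have hw0 : ∀ σ x, edgeParity Function.Embedding.inl σ x = shiftedParity (t := t) (B := B) σ x false := by
    intro σ x; ext l; simp [shiftedParity]
  have hw1 : ∀ σ x, (fun l => !edgeParity Function.Embedding.inl σ x l)
      = shiftedParity (t := t) (B := B) σ x true := by
    intro σ x; ext l; simp [shiftedParity]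
  have hlow : ∀ σ x, 1 - bad false σ x - dev false σ x
      ≤ G ((assignmentStream γ e x).foldl A.step A.init) σ (shiftedParity σ x false) := by
    intro σ x
    rcases hbad01 false σ x with h1 | h1
    · rcases hdev01 false σ x with h2 | h2
      · rw [hGeq, if_pos (hnear false σ x h1 h2)]
        linarith
      · linarith [hG0 ((assignmentStream γ e x).foldl A.step A.init) σ (shiftedParity σ x false)]
    · rcases hdev01 false σ x with h2 | h2 <;>
        linarith [hG0 ((assignmentStream γ e x).foldl A.step A.init) σ (shiftedParity σ x false)]
  have hupp : ∀ σ x, G ((assignmentStream γ e x).foldl A.step A.init) σ (shiftedParity σ x true)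
      ≤ bad true σ x + dev true σ x := by
    intro σ x
    rcases hbad01 true σ x with h1 | h1
    · rcases hdev01 true σ x with h2 | h2
      · have h3 := hnear true σ x h1 h2
        have h4 := abs_sub_le (center false) (A.run (hardStream γ e i₀ σ x true)) (center true)
        rw [hcenters, abs_sub_comm (center false)] at h4
        rw [hGeq, if_neg (by linarith), h1, h2]
        simp
      · linarith [hG1 ((assignmentStream γ e x).foldl A.step A.init) σ (shiftedParity σ x true)]
    · rcases hdev01 true σ x with h2 | h2 <;>
        linarith [hG1 ((assignmentStream γ e x).foldl A.step A.init) σ (shiftedParity σ x true)]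
  have hbads : (𝔼 σ : Equiv.Perm (HypermatchingVar t B), 𝔼 x, (bad false σ x + bad true σ x))
      ≤ 2 * δ := by
    rw [← Finset.univ_product_univ, Finset.expect_product, ← Finset.univ_product_univ,
      Finset.expect_product] at hA
    have h1 : ∀ σ x, bad false σ x + bad true σ x = 2 * 𝔼 b : Bool, bad b σ x := by
      intro σ x
      rw [Fintype.expect_eq_sum_div_card, Fintype.sum_bool, Fintype.card_bool]
      push_cast
      ring
    simp only [h1, ← Finset.mul_expect]
    linarith
  have hdevs : (𝔼 σ : Equiv.Perm (HypermatchingVar t B), 𝔼 x, (dev false σ x + dev true σ x))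
      ≤ 2 * (B * (4 * M) ^ 2 / (Δ / 4 * B) ^ 2) := by
    refine Finset.expect_le Finset.univ_nonempty fun σ _ => ?_
    rw [Finset.expect_add_distrib]
    linarith [hdev_le false σ, hdev_le true σ]
  simp only [hw1]
  simp only [hw0]
  calc 1 - 2 * δ - 2 * (B * (4 * M) ^ 2 / (Δ / 4 * B) ^ 2)
      ≤ 𝔼 σ : Equiv.Perm (HypermatchingVar t B), 𝔼 x,
          (1 - (bad false σ x + bad true σ x) - (dev false σ x + dev true σ x)) := by
        simp only [Finset.expect_sub_distrib, Fintype.expect_const]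
        linarith
    _ ≤ _ := Finset.expect_le_expect fun σ _ => Finset.expect_le_expect fun x _ => by
        linarith [hlow σ x, hupp σ x]

/-- A streaming algorithm with little memory is no good approximation of `f`: for an average error
`δ` on the hard streams, `1 - 2 δ` is bounded in terms of its memory. -/
theorem one_sub_two_mul_error_le (hf : RelabellingInvariant f) (ha : DiagonallyBlockAdditive f)
    {m : ℕ} (hm : t + d = m) (ht : Even t) (ht0 : 0 < t) (hB : 0 < B)
    (hN : (256 * t + 4 * d) * B + R = N)
    {c M C Δ δ : ℝ} (hc : 0 ≤ c) (hΔ : 0 < Δ)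
    (hM : ∀ q ≤ t, |f (m + m) (blockM γ m q)| ≤ M)
    (hgap : |parityExpectation false t (fun q => f (m + m) (blockM γ m q))
      - parityExpectation true t (fun q => f (m + m) (blockM γ m q))| = Δ)
    (hC : 2 * M * B + |offsetValue f γ t B R| ≤ C * B) (hcC : c * C ≤ Δ / 2)
    (hS : (S : ℝ) ^ t / B ^ (t - 1) ≤ 1)
    {Ω : Type*} [MeasurableSpace Ω] (μ : Measure Ω) [IsProbabilityMeasure μ]
    (A : Ω → StreamingAlgorithm N S) {𝒮 : Set (List (Update N))}
    (h𝒮 : insertionStreams N {1, Real.sqrt γ} ⊆ 𝒮) (hA : ApproximatesWithin μ A f 𝒮 c δ) :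
    ∃ a : ℝ, 1 - 2 * δ - 2 * (B * (4 * M) ^ 2 / (Δ / 4 * B) ^ 2) ≤ a ∧
      a ^ 2 ≤ (S : ℝ) ^ t / B ^ (t - 1) + 1 / B := by
  let e : Fin N ≃ HardIndex t d B R :=
    (Fintype.equivFinOfCardEq (card_hardIndex.trans hN)).symm
  let i₀ : Fin t := ⟨0, ht0⟩
  obtain ⟨ω, hω⟩ := exists_expect_mem_le μ
    (fun p : (Equiv.Perm (HypermatchingVar t B) × (HypermatchingVar t B → Bool)) × Bool =>
      {ω | ¬ |(A ω).run (hardStream γ e i₀ p.1.1 p.1.2 p.2)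
          - f N (streamMatrix (hardStream γ e i₀ p.1.1 p.1.2 p.2))|
        ≤ c * |f N (streamMatrix (hardStream γ e i₀ p.1.1 p.1.2 p.2))|})
    fun p => hA _ (h𝒮 (hardStream_mem γ e i₀ p.1.1 p.1.2 p.2))
  obtain ⟨G, hG0, hG1, hG⟩ := le_advantage hf ha hm ht ht0 hB e i₀ hc hΔ hM hgap hC hcC (A ω) (by
    refine le_trans (le_of_eq (Finset.expect_congr rfl fun p _ => ?_)) hω
    simp only [Set.indicator_apply, Set.mem_ofPred_eq])
  have ht2 : 2 ≤ t := by
    obtain ⟨k, rfl⟩ := ht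
    omega
  exact ⟨_, hG, advantage_sq_le_of_bits ht2 hB hS (card_hypermatchingVar t B)
    (by simp) _ Function.Embedding.inl G hG0 hG1⟩

end Protocol

lemma pow_le_of_le_rpow {t N S : ℕ} (ht : 0 < t) {K : ℝ}
    (h : (S : ℝ) ≤ K * (N : ℝ) ^ (1 - 1 / (t : ℝ))) :
    (S : ℝ) ^ t ≤ K ^ t * (N : ℝ) ^ (t - 1) := by
  refine (pow_le_pow_left₀ S.cast_nonneg h t).trans_eq ?_
  have ht' : (t : ℝ) ≠ 0 := by exact_mod_cast ht.ne'
  rw [mul_pow, ← Real.rpow_natCast ((N : ℝ) ^ _) t, ← Real.rpow_mul N.cast_nonneg, sub_mul,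
    one_div_mul_cancel ht', one_mul, ← Real.rpow_natCast (N : ℝ) (t - 1), Nat.cast_sub ht,
    Nat.cast_one]

lemma pow_div_le_of_le_rpow {t N S B D : ℕ} (ht : 0 < t) (hB : 0 < B) (hD : 1 ≤ D)
    (hN : (N : ℝ) ≤ 2 * D * B) {η : ℝ} (hη0 : 0 < η) (hη1 : η ≤ 1)
    (h : (S : ℝ) ≤ η / (4 * (2 * D) ^ (t - 1)) * (N : ℝ) ^ (1 - 1 / (t : ℝ))) :
    (S : ℝ) ^ t / B ^ (t - 1) ≤ η / 4 := by
  have hB' : (0 : ℝ) < B := by exact_mod_cast hB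
  have hD' : (1 : ℝ) ≤ D := by exact_mod_cast hD
  have hDpow : (1 : ℝ) ≤ (2 * D) ^ (t - 1) := one_le_pow₀ (by linarith)
  have hK0 : 0 ≤ η / (4 * (2 * D) ^ (t - 1)) := by positivity
  have hK1 : η / (4 * (2 * D) ^ (t - 1)) ≤ 1 := by
    rw [div_le_one (by positivity)]
    linarith
  rw [div_le_iff₀ (by positivity)]
  calc (S : ℝ) ^ t ≤ (η / (4 * (2 * D) ^ (t - 1))) ^ t * (N : ℝ) ^ (t - 1) :=
        pow_le_of_le_rpow ht h
    _ ≤ η / (4 * (2 * D) ^ (t - 1)) * (2 * D * B) ^ (t - 1) := by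
        gcongr
        exact pow_le_of_le_one hK0 hK1 ht.ne'
    _ = η / 4 * B ^ (t - 1) := by
        rw [mul_pow (2 * D : ℝ)]
        field_simp

lemma advantage_contradiction {θ Δ Q B a : ℝ} (hθ : 0 < θ) (hΔ : 0 < Δ) (hB : 1 ≤ B)
    (hB1 : 8 * Q ^ 2 / ((Δ / 4) ^ 2 * θ) ≤ B) (hB2 : 8 / θ ^ 2 ≤ B)
    (ha1 : θ - 2 * (B * Q ^ 2 / (Δ / 4 * B) ^ 2) ≤ a) (ha2 : a ^ 2 ≤ θ ^ 2 / 4 + 1 / B) :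
    False := by
  have hB0 : 0 < B := by linarith
  have hdev : B * Q ^ 2 / (Δ / 4 * B) ^ 2 ≤ θ / 8 := by
    rw [div_le_iff₀ (by positivity)] at hB1 ⊢
    calc B * Q ^ 2 ≤ B * (B * ((Δ / 4) ^ 2 * θ) / 8) := by
          refine mul_le_mul_of_nonneg_left ?_ hB0.le
          linarith
      _ = θ / 8 * (Δ / 4 * B) ^ 2 := by ring
  have hinv : 1 / B ≤ θ ^ 2 / 8 := by
    rw [div_le_iff₀ (by positivity)] at hB2 ⊢
    linarith
  have ha3 : 3 / 4 * θ ≤ a := by linarith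
  have ha4 : (3 / 4 * θ) ^ 2 ≤ a ^ 2 := pow_le_pow_left₀ (by positivity) ha3 2
  nlinarith [pow_pos hθ 2]

theorem mainTheorem4 (t : ℕ) (ht : Even t) (ht0 : 0 < t) (m : ℕ) (hm : t ≤ m) :
    -- the hidden constant of the space bound: it depends on `t`, `m = m(t)` and the error `δ` only
    ∃ K : ℝ → ℝ, (∀ δ : ℝ, δ < 1 / 2 → 0 < K δ) ∧
      ∀ (γ : ℝ), 0 < γ →
      ∀ (f : SquareMatrixFunction), RelabellingInvariant f → DiagonallyBlockAdditive f →
        evenExpectation t (fun q => f (m + m) (blockM γ m q))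
          - oddExpectation t (fun q => f (m + m) (blockM γ m q)) ≠ 0 →
        ∃ c : ℝ, 0 < c ∧
          ∀ δ : ℝ, δ < 1 / 2 → ∃ N₀ : ℕ, ∀ N : ℕ, N₀ ≤ N →
            -- any class of admissible streams with the single insertions of `1` and `√γ`
            ∀ (𝒮 : Set (List (Update N))), insertionStreams N {1, Real.sqrt γ} ⊆ 𝒮 →
            ∀ (S : ℕ) (Ω : Type*) [MeasurableSpace Ω] (μ : Measure Ω) [IsProbabilityMeasure μ]
              (A : Ω → StreamingAlgorithm N S),
              ApproximatesWithin μ A f 𝒮 c δ →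
              K δ * (N : ℝ) ^ (1 - 1 / (t : ℝ)) ≤ (S : ℝ) := by
  obtain ⟨d, hd⟩ : ∃ d, t + d = m := ⟨m - t, by omega⟩
  set D : ℕ := 256 * t + 4 * d with hD
  have hD1 : 1 ≤ D := by omega
  have hD1' : (1 : ℝ) ≤ D := by exact_mod_cast hD1
  have hDpow : (1 : ℝ) ≤ (2 * D) ^ (t - 1) := one_le_pow₀ (by linarith)
  have hθ : ∀ δ : ℝ, δ < 1 / 2 → 0 < min 1 ((1 - 2 * δ) ^ 2) := fun δ hδ =>
    lt_min one_pos (pow_pos (by linarith) 2)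
  refine ⟨fun δ => min 1 ((1 - 2 * δ) ^ 2) / (4 * (2 * D) ^ (t - 1)),
    fun δ hδ => div_pos (hθ δ hδ) (by positivity), fun γ _ f hf ha hne => ?_⟩
  set F : ℕ → ℝ := fun q => f (m + m) (blockM γ m q) with hF
  set Δ : ℝ := |parityExpectation false t F - parityExpectation true t F| with hΔdef
  have hΔ : 0 < Δ := abs_pos.2 hne
  set M : ℝ := ∑ q ∈ Finset.range (t + 1), |F q| with hMdef
  have hM : ∀ q ≤ t, |F q| ≤ M := fun q hq =>
    Finset.single_le_sum (f := fun q => |F q|) (fun _ _ => abs_nonneg _)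
      (Finset.mem_range.2 (Nat.lt_succ_of_le hq))
  have hM0 : 0 ≤ M := Finset.sum_nonneg fun _ _ => abs_nonneg _
  set r : ℝ := |singleValue f γ true + singleValue f γ false| with hr
  set z : ℝ := |evalOn f (0 : Matrix Unit Unit ℝ)| with hz
  set C : ℝ := 2 * M + 63 * t * r + D * z with hCdef
  have hC0 : 0 ≤ C := by positivity
  refine ⟨Δ / (2 * (C + 1)), by positivity, fun δ hδ => ?_⟩
  set θ : ℝ := 1 - 2 * δ with hθdef
  have hθ0 : 0 < θ := by linarith
  obtain ⟨B₀, hB₀⟩ := exists_nat_ge (max (8 * (4 * M) ^ 2 / ((Δ / 4) ^ 2 * θ)) (8 / θ ^ 2))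
  refine ⟨D * (B₀ + 1), fun N hN 𝒮 h𝒮 S Ω _ μ _ A hA => ?_⟩
  set B := N / D with hBdef
  set R := N % D with hRdef
  have hBB₀ : B₀ + 1 ≤ B := (Nat.le_div_iff_mul_le hD1).2 (by rwa [mul_comm])
  have hBpos : 0 < B := by omega
  have hBR : (256 * t + 4 * d) * B + R = N := Nat.div_add_mod N D
  have hRD : R < D := Nat.mod_lt N hD1
  have hB' : (1 : ℝ) ≤ B := by exact_mod_cast hBpos
  have hBB₀' : (B₀ : ℝ) ≤ B := by exact_mod_cast (Nat.le_succ B₀).trans hBB₀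
  have hRB : (R : ℝ) ≤ D * B := by
    have : (R : ℝ) ≤ D := by exact_mod_cast hRD.le
    nlinarith
  have hoff : 2 * M * B + |offsetValue f γ t B R| ≤ C * B := by
    have h1 : |offsetValue f γ t B R| ≤ 63 * t * B * r + R * z := by
      refine (abs_add_le _ _).trans (le_of_eq ?_)
      rw [abs_mul, abs_mul, Nat.abs_cast, Nat.abs_cast]
      push_cast
      rfl
    have h2 : R * z ≤ D * B * z := mul_le_mul_of_nonneg_right hRB (abs_nonneg _)
    calc _ ≤ 2 * M * B + (63 * t * B * r + D * B * z) := by linarith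
      _ = C * B := by rw [hCdef]; ring
  have hcC : Δ / (2 * (C + 1)) * C ≤ Δ / 2 := by
    rw [div_mul_eq_mul_div, div_le_div_iff₀ (by positivity) two_pos]
    nlinarith
  by_contra hcon
  have hNB : (N : ℝ) ≤ 2 * D * B := by
    have : (N : ℝ) = D * B + R := by exact_mod_cast hBR.symm
    linarith
  have hS := pow_div_le_of_le_rpow ht0 hBpos hD1 hNB (hθ δ hδ) (min_le_left _ _)
    (not_le.1 hcon).le
  obtain ⟨a, ha1, ha2⟩ := one_sub_two_mul_error_le (γ := γ) hf ha hd ht ht0 hBpos hBR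
    (by positivity) hΔ hM rfl hoff hcC (hS.trans (by linarith [min_le_left 1 (θ ^ 2)])) μ A h𝒮 hA
  exact advantage_contradiction hθ0 hΔ hB' ((le_max_left _ _).trans (hB₀.trans hBB₀'))
    ((le_max_right _ _).trans (hB₀.trans hBB₀')) ha1
    (ha2.trans (add_le_add_left (hS.trans (div_le_div_of_nonneg_right (min_le_right _ _)
      (by norm_num))) _))
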